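/- Fix a set $C$ of colours. A \emph{hypergraph} is a pair $G=(V(G),E(G))$ with a finite (possibly empty) vertex set and a finite set of edges $(v_1,\dots,v_r;c)$, where $r\ge 2$, the $v_i$ are distinct vertices and $c\in C$. Isomorphisms preserve the direction and the colour of edges; $G[U]$ is the subhypergraph induced by $U\subseteq V(G)$ (its edges are the edges of $G$ contained in $U$), $kG$ is the disjoint union of $k$ copies of $G$, and $K_1$ has one vertex and no edges. For hypergraphs $G_1,\dots,G_n$ with disjoint vertex sets, $G_1*\cdots*G_n$ is the class of all hypergraphs with vertex set $\bigcup_i V(G_i)$ which induce $G_i$ on $V(G_i)$ for every $i$ (taken up to isomorphism). A \emph{property} is a nonempty isomorphism-closed class of hypergraphs. It is \emph{induced-hereditary} if it is closed under taking induced subhypergraphs, and \emph{additive} if it is closed under disjoint unions. The product $\mathcal P_1\circ\cdots\circ\mathcal P_n$ is the class of all hypergraphs $H$ whose vertex set has a partition $(V_1,\dots,V_n)$, empty parts allowed, with $H[V_i]\in\mathcal P_i$ for all $i$. A \emph{$\mathcal P$-decomposition} of $G$ with $n$ parts is a partition $(V_1,\dots,V_n)$ of $V(G)$ into nonempty parts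 such that $kG[V_1]*\cdots*kG[V_n]\subseteq\mathcal P$ for all integers $k\ge 1$. Let $dec_{\mathcal P}(G)$ be the largest number of parts in a $\mathcal P$-decomposition of $G$, and $0$ if $G\notin\mathcal P$. A hypergraph $G$ is \emph{$\mathcal P$-strict} if $G\in\mathcal P$ and $G*K_1\not\subseteq\mathcal P$. Let $dec(\mathcal P)$ be the minimum of $dec_{\mathcal P}(G)$ over all $\mathcal P$-strict hypergraphs $G$ (and $\infty$ if there are none). A property $\mathcal P$ is \emph{indecomposable} if $dec(\mathcal P)=1$. \textbf{Theorem.} Let $\mathcal P$ be an additive induced-hereditary property with $n:=dec(\mathcal P)$ finite. If $$\mathcal P=\mathcal P_1\circ\cdots\circ\mathcal P_n=\mathcal Q_1\circ\cdots\circ\mathcal Q_n,$$ where all $\mathcal P_i$ and $\mathcal Q_i$ are indecomposable additive induced-hereditary properties, then there is a permutation $\sigma$ of $\{1,\dots,n\}$ such that $\mathcal Q_i=\mathcal P_{\sigma(i)}$ for all $i$. That is, $\mathcal P$ has at most one factorisation into exactly $dec(\mathcal P)$ indecomposable additive induced-hereditary factors, up to the order of the factors. -/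

import Mathlib

universe u

/-- A finite directed coloured hypergraph with colours in `C`: a finite vertex set and a finite set
of edges `(v₁, …, v_r; c)`, where `v₁, …, v_r` are distinct vertices, `r ≥ 2` (no loops), and `c` is
the colour of the edge. The null hypergraph (no vertices) is allowed. -/
structure DCHypergraph (C : Type u) where
  V : Type
  finite_V : Finite V
  E : Set (List V × C)
  finite_E : E.Finite
  two_le : ∀ e ∈ E, 2 ≤ e.1.length
  nodup : ∀ e ∈ E, e.1.Nodup

namespace DCHypergraph

variable {C : Type u}

/-- The action of a map of vertices on coloured tuples. -/
def mapEdge {α β : Type} (f : α → β) (e : List α × C) : List β × C := (e.1.map f, e.2)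

theorem mapEdge_injective {α β : Type} {f : α → β} (hf : Function.Injective f) :
    Function.Injective (mapEdge (C := C) f) := by
  rintro ⟨l, c⟩ ⟨l', c'⟩ h
  simp only [mapEdge, Prod.mk.injEq] at h
  rw [List.map_injective_iff.mpr hf h.1, h.2]

/-- Isomorphism: a bijection of the vertices which preserves and reflects edges, with their
directions and colours. -/
def Iso (G H : DCHypergraph C) : Prop :=
  ∃ f : G.V ≃ H.V, ∀ e : List G.V × C, e ∈ G.E ↔ mapEdge f e ∈ H.E

/-- The subhypergraph `H[U]` induced by `U`: its edges are the edges of `H` contained in `U`. -/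
def induce (H : DCHypergraph C) (U : Set H.V) : DCHypergraph C where
  V := U
  finite_V := by
    have := H.finite_V
    infer_instance
  E := {e | mapEdge Subtype.val e ∈ H.E}
  finite_E := H.finite_E.preimage (mapEdge_injective Subtype.val_injective).injOn
  two_le := by
    intro e he
    simpa [mapEdge] using H.two_le _ he
  nodup := by
    intro e he
    exact List.Nodup.of_map _ (H.nodup _ he)

/-- `K ≤ H`: `K` is isomorphic to `H[U]` for some set `U` of vertices. -/
def IsInducedSub (K H : DCHypergraph C) : Prop :=
  ∃ U : Set H.V, Iso K (H.induce U)

/-- The disjoint union of a finite family of hypergraphs. -/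
def disjUnion {n : ℕ} (G : Fin n → DCHypergraph C) : DCHypergraph C where
  V := Σ i, (G i).V
  finite_V := by
    have := fun i => (G i).finite_V
    infer_instance
  E := ⋃ i, mapEdge (Sigma.mk i) '' (G i).E
  finite_E := Set.finite_iUnion fun i => (G i).finite_E.image _
  two_le := by
    intro e he
    obtain ⟨i, e', he', rfl⟩ := Set.mem_iUnion.mp he
    simpa [mapEdge] using (G i).two_le _ he'
  nodup := by
    intro e he
    obtain ⟨i, e', he', rfl⟩ := Set.mem_iUnion.mp he
    exact ((G i).nodup _ he').map sigma_mk_injective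

/-- `kG`, the disjoint union of `k` copies of `G`. -/
def copies (k : ℕ) (G : DCHypergraph C) : DCHypergraph C :=
  disjUnion fun _ : Fin k => G

/-- The hypergraph `K₁` with one vertex and no edges. -/
def K1 : DCHypergraph C where
  V := Unit
  finite_V := inferInstance
  E := ∅
  finite_E := Set.finite_empty
  two_le := by simp
  nodup := by simp

/-- The `*`-join `G₁ * ⋯ * Gₙ`: all hypergraphs whose vertex set is the disjoint union of the
vertex sets of the `Gᵢ` (up to a bijection `f`), and which induce `Gᵢ` on the vertices of `Gᵢ`;
the edges meeting several `Gᵢ` are arbitrary. -/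
def join {n : ℕ} (G : Fin n → DCHypergraph C) : Set (DCHypergraph C) :=
  {H | ∃ f : (Σ i, (G i).V) ≃ H.V, ∀ i, ∀ e : List (G i).V × C,
    e ∈ (G i).E ↔ mapEdge (fun v => f ⟨i, v⟩) e ∈ H.E}

/-- A hypergraph property: a nonempty isomorphism-closed class of hypergraphs. -/
def IsProperty (P : Set (DCHypergraph C)) : Prop :=
  P.Nonempty ∧ ∀ G H : DCHypergraph C, Iso G H → G ∈ P → H ∈ P

def IsInducedHereditary (P : Set (DCHypergraph C)) : Prop :=
  ∀ K H : DCHypergraph C, IsInducedSub K H → H ∈ P → K ∈ P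

/-- Closed under the disjoint union of two hypergraphs. -/
def IsAdditive (P : Set (DCHypergraph C)) : Prop :=
  ∀ G H : DCHypergraph C, G ∈ P → H ∈ P → disjUnion ![G, H] ∈ P

/-- Additive induced-hereditary hypergraph properties. -/
structure IsAdditiveInducedHereditary (P : Set (DCHypergraph C)) : Prop where
  isProperty : IsProperty P
  isInducedHereditary : IsInducedHereditary P
  isAdditive : IsAdditive P

/-- The product `P₁ ∘ ⋯ ∘ Pₙ`: all hypergraphs whose vertex set has a partition `(V₁, …, Vₙ)`,
empty parts allowed, such that the subhypergraph induced by `Vᵢ` is in `Pᵢ` for every `i`.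
The partition is given by the map `c` with `Vᵢ = c ⁻¹' {i}`. -/
def product {n : ℕ} (P : Fin n → Set (DCHypergraph C)) : Set (DCHypergraph C) :=
  {H | ∃ c : H.V → Fin n, ∀ i, H.induce (c ⁻¹' {i}) ∈ P i}

/-- The partition of `V(G)` into the parts `Vᵢ = c ⁻¹' {i}` is a `P`-decomposition with `n` parts:
all parts are nonempty, and `k G[V₁] * ⋯ * k G[Vₙ] ⊆ P` for every positive integer `k`. -/
def IsDecomposition (P : Set (DCHypergraph C)) (G : DCHypergraph C) {n : ℕ} (c : G.V → Fin n) :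
    Prop :=
  Function.Surjective c ∧
    ∀ k : ℕ, 1 ≤ k → join (fun i => copies k (G.induce (c ⁻¹' {i}))) ⊆ P

/-- The decomposability number `dec_P(G)`: the largest number of parts in a `P`-decomposition of
`G` (at most the number of vertices of `G`), and `0` if `G ∉ P`. -/
noncomputable def graphDec (P : Set (DCHypergraph C)) (G : DCHypergraph C) : ℕ∞ :=
  sSup {m : ℕ∞ | G ∈ P ∧ ∃ (n : ℕ) (c : G.V → Fin n), IsDecomposition P G c ∧ m = n}

/-- The set `S(P)` of `P`-strict hypergraphs: `G ∈ P`, but `G * K₁ ⊄ P`. -/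
def strict (P : Set (DCHypergraph C)) : Set (DCHypergraph C) :=
  {G | G ∈ P ∧ ¬ join ![G, K1] ⊆ P}

/-- The decomposability number `dec(P)`: the minimum of `dec_P(G)` over the `P`-strict
hypergraphs `G`. It is `⊤` if there are none, as for the class of all hypergraphs. -/
noncomputable def dec (P : Set (DCHypergraph C)) : ℕ∞ :=
  ⨅ G ∈ strict P, graphDec P G

def IsIndecomposable (P : Set (DCHypergraph C)) : Prop :=
  dec P = 1

/-- `P = P₁ ∘ ⋯ ∘ Pₙ`, where the `Pᵢ` are indecomposable additive induced-hereditary properties. -/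
structure IsIndecomposableFactorisation (P : Set (DCHypergraph C)) {n : ℕ}
    (F : Fin n → Set (DCHypergraph C)) : Prop where
  factor : ∀ i, IsAdditiveInducedHereditary (F i)
  indecomposable : ∀ i, IsIndecomposable (F i)
  eq_product : P = product F

end DCHypergraph

namespace DCHypergraph

variable {C : Type u}

/-! Let `A` and `B` be the two factorisations and `G₀` a strict hypergraph with `graphDec P G₀ ≤ n`.
Let `G` contain `G₀` as an induced subhypergraph. By strictness, decompositions of `G` restrict to
`G₀` (`IsDecomposition.comp_isEmb`), so none has more than `n` parts. All factors contain `K1`, by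
indecomposability, so every colouring of `G` for `A` or `B` uses all `n` colours
(`surjective_of_mem_strict`).

The heart is `exists_perm_induce_mem`: a colouring `U` of `G` for `A` becomes one for `B` after
permuting the colours. Suppose not, and let `f` be a surjective colouring that is not a permutation
of `U`. The common refinement of `U` and `f` has more than `n` classes, so it is not a
decomposition: some `Z ∉ P` lies in a join of multiples of its classes. The edges of `Z` that cross
classes of `U` form a pattern; placed between copies of `G`, they prevent all copies from being
coloured by `f`. A Ramsey-type product (`Pattern.exists_monochromatic`) merges the patterns of all
`f` into one pattern `Q`. The copies of `G` in its blow-up can all be coloured by `U`, because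
pattern edges cross the classes of `U`. So the blow-up lies in the product of `A`, hence has a
colouring for `B`, and this colouring agrees with a single `f` on a copy of the pattern of `f`, a
contradiction.

Applied to the disjoint union of `G₀` and a tuple `H i ∈ A i`, this gives a permutation for each
tuple. There are finitely many permutations, so one of them serves all tuples
(`exists_perm_forall_subset`). Inclusions up to permutation in both directions force equality
(`exists_perm_eq_of_subset`). -/

/-! ### Coloured tuples and embeddings -/

theorem mapEdge_mapEdge {α β γ : Type} (f : α → β) (g : β → γ) (e : List α × C) :
    mapEdge g (mapEdge f e) = mapEdge (g ∘ f) e := by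
  simp [mapEdge]

theorem mapEdge_congr {α β : Type} {f g : α → β} {e : List α × C} (h : ∀ x ∈ e.1, f x = g x) :
    mapEdge f e = mapEdge g e := by
  simp only [mapEdge, Prod.mk.injEq, and_true]
  exact List.map_congr_left h

theorem mapEdge_id {α : Type} (e : List α × C) : mapEdge id e = e := by
  simp [mapEdge]

theorem forall_mem_mapEdge {α β : Type} {f : α → β} {e : List α × C} {p : β → Prop} :
    (∀ y ∈ (mapEdge f e).1, p y) ↔ ∀ x ∈ e.1, p (f x) := by
  simp [mapEdge]

theorem mem_mapEdge {α β : Type} (f : α → β) {e : List α × C} {x : α} (h : x ∈ e.1) :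
    f x ∈ (mapEdge f e).1 :=
  List.mem_map_of_mem h

theorem exists_mapEdge {α β : Type} {f : α → β} {e : List β × C} (h : ∀ x ∈ e.1, x ∈ Set.range f) :
    ∃ e' : List α × C, mapEdge f e' = e := by
  have : e.1 ∈ Set.range (List.map f) := by
    rw [Set.range_list_map]
    exact h
  obtain ⟨l, hl⟩ := this
  exact ⟨(l, e.2), by simp [mapEdge, hl]⟩

theorem ne_nil_of_mem {H : DCHypergraph C} {e : List H.V × C} (he : e ∈ H.E) : e.1 ≠ [] := by
  intro h
  have := H.two_le e he
  simp [h] at this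

theorem exists_mem_of_mem {H : DCHypergraph C} {e : List H.V × C} (he : e ∈ H.E) :
    ∃ x, x ∈ e.1 :=
  List.exists_mem_of_ne_nil _ (ne_nil_of_mem he)

theorem not_forall_eq_of_mem {H : DCHypergraph C} {e : List H.V × C} (he : e ∈ H.E) (v : H.V) :
    ¬ ∀ x ∈ e.1, x = v := by
  intro h
  have h1 := H.two_le e he
  have h2 := H.nodup e he
  rw [List.eq_replicate_of_mem h, List.nodup_replicate] at h2
  omega

/-- An embedding: an injective map of the vertices which preserves and reflects edges. -/
def IsEmb (K H : DCHypergraph C) (f : K.V → H.V) : Prop :=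
  Function.Injective f ∧ ∀ e, e ∈ K.E ↔ mapEdge f e ∈ H.E

theorem IsEmb.comp {K H L : DCHypergraph C} {f : K.V → H.V} {g : H.V → L.V}
    (hg : IsEmb H L g) (hf : IsEmb K H f) : IsEmb K L (g ∘ f) :=
  ⟨hg.1.comp hf.1, fun e => by rw [hf.2, hg.2, mapEdge_mapEdge]⟩

theorem IsEmb.refl (H : DCHypergraph C) : IsEmb H H id :=
  ⟨Function.injective_id, fun e => by rw [mapEdge_id]⟩

/-- The inclusion of the vertices of an induced subhypergraph. -/
def inVal (H : DCHypergraph C) (U : Set H.V) (x : (H.induce U).V) : H.V := Subtype.val x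

theorem inVal_mem {H : DCHypergraph C} {U : Set H.V} (x : (H.induce U).V) : inVal H U x ∈ U :=
  Subtype.property x

theorem isEmb_inVal (H : DCHypergraph C) (U : Set H.V) : IsEmb (H.induce U) H (inVal H U) :=
  ⟨Subtype.val_injective, fun _ => Iff.rfl⟩

theorem exists_inVal_eq {H : DCHypergraph C} {U : Set H.V} {v : H.V} (hv : v ∈ U) :
    ∃ x, inVal H U x = v :=
  ⟨⟨v, hv⟩, rfl⟩

theorem IsEmb.exists_codRestrict {K H : DCHypergraph C} {f : K.V → H.V} (hf : IsEmb K H f)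
    {U : Set H.V} (h : ∀ x, f x ∈ U) :
    ∃ g : K.V → (H.induce U).V, IsEmb K (H.induce U) g ∧ ∀ x, inVal H U (g x) = f x := by
  choose g hg using fun x => exists_inVal_eq (h x)
  refine ⟨g, ⟨fun x y hxy => hf.1 ?_, fun e => ?_⟩, hg⟩
  · rw [← hg, ← hg, hxy]
  · rw [hf.2, (isEmb_inVal H U).2, mapEdge_mapEdge, mapEdge_congr]
    exact fun x _ => (hg x).symm

theorem IsEmb.isInducedSub {K H : DCHypergraph C} {f : K.V → H.V} (hf : IsEmb K H f) :
    IsInducedSub K H := by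
  obtain ⟨g, hg, h⟩ := hf.exists_codRestrict (U := Set.range f) (fun x => ⟨x, rfl⟩)
  refine ⟨Set.range f, Equiv.ofBijective g ⟨hg.1, fun y => ?_⟩, hg.2⟩
  obtain ⟨x, hx⟩ := inVal_mem y
  exact ⟨x, (isEmb_inVal H _).1 (by rw [h, hx])⟩

theorem IsAdditiveInducedHereditary.of_emb {P : Set (DCHypergraph C)}
    (hP : IsAdditiveInducedHereditary P) {K H : DCHypergraph C} {f : K.V → H.V}
    (hf : IsEmb K H f) (hH : H ∈ P) : K ∈ P :=
  hP.isInducedHereditary K H hf.isInducedSub hH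

/-- A map from a hypergraph into `H` which is injective and reflects edges on `U` shows that
`G[U]` is in every hereditary property that contains `H`. -/
theorem IsAdditiveInducedHereditary.induce_mem {P : Set (DCHypergraph C)}
    (hP : IsAdditiveInducedHereditary P) {G H : DCHypergraph C} {U : Set G.V} (hH : H ∈ P)
    {f : G.V → H.V} (hf : Set.InjOn f U)
    (h : ∀ e : List G.V × C, (∀ x ∈ e.1, x ∈ U) → (e ∈ G.E ↔ mapEdge f e ∈ H.E)) :
    G.induce U ∈ P := by
  refine hP.of_emb (f := f ∘ inVal G U) ⟨fun x y hxy => ?_, fun e => ?_⟩ hH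
  · exact (isEmb_inVal G U).1 (hf (inVal_mem x) (inVal_mem y) hxy)
  · rw [(isEmb_inVal G U).2, h, mapEdge_mapEdge]
    rw [forall_mem_mapEdge]
    exact fun x _ => inVal_mem x

/-- The version of `IsAdditiveInducedHereditary.induce_mem` for a map into `H[W]`. -/
theorem IsAdditiveInducedHereditary.induce_mem_induce {P : Set (DCHypergraph C)}
    (hP : IsAdditiveInducedHereditary P) {G H : DCHypergraph C} {U : Set G.V} {W : Set H.V}
    (hH : H.induce W ∈ P) {f : G.V → H.V} (hU : ∀ x ∈ U, f x ∈ W) (hf : Set.InjOn f U)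
    (h : ∀ e : List G.V × C, (∀ x ∈ e.1, x ∈ U) → (e ∈ G.E ↔ mapEdge f e ∈ H.E)) :
    G.induce U ∈ P := by
  have : IsEmb (G.induce U) H (f ∘ inVal G U) := by
    refine ⟨fun x y hxy => (isEmb_inVal G U).1 (hf (inVal_mem x) (inVal_mem y) hxy), fun e => ?_⟩
    rw [(isEmb_inVal G U).2, h, mapEdge_mapEdge]
    rw [forall_mem_mapEdge]
    exact fun x _ => inVal_mem x
  obtain ⟨g, hg, -⟩ := this.exists_codRestrict (U := W) (fun x => hU _ (inVal_mem x))
  exact hP.of_emb hg hH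

/-! ### Disjoint unions and additive properties -/

/-- The inclusion of a summand of a disjoint union. -/
def duMk {n : ℕ} (G : Fin n → DCHypergraph C) (i : Fin n) (v : (G i).V) : (disjUnion G).V :=
  (⟨i, v⟩ : Σ i, (G i).V)

/-- The index of the summand containing a vertex of a disjoint union. -/
def duFst {n : ℕ} (G : Fin n → DCHypergraph C) (x : (disjUnion G).V) : Fin n :=
  Sigma.fst x

theorem duFst_duMk {n : ℕ} (G : Fin n → DCHypergraph C) (i : Fin n) (v : (G i).V) :
    duFst G (duMk G i v) = i := rfl

theorem exists_duMk_eq {n : ℕ} {G : Fin n → DCHypergraph C} {x : (disjUnion G).V} {i : Fin n}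
    (h : duFst G x = i) : ∃ v, duMk G i v = x := by
  subst h
  exact ⟨Sigma.snd x, rfl⟩

theorem duFst_eq_of_mem {n : ℕ} {G : Fin n → DCHypergraph C}
    {e : List (disjUnion G).V × C} (he : e ∈ (disjUnion G).E) :
    ∃ i, ∀ x ∈ e.1, duFst G x = i := by
  obtain ⟨i, e', h', rfl⟩ := Set.mem_iUnion.mp he
  exact ⟨i, forall_mem_mapEdge.mpr fun _ _ => rfl⟩

theorem isEmb_duMk {n : ℕ} (G : Fin n → DCHypergraph C) (i : Fin n) :
    IsEmb (G i) (disjUnion G) (duMk G i) := by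
  have hinj : ∀ i, Function.Injective (duMk G i) := fun i x y h =>
    eq_of_heq (Sigma.mk.inj h).2
  refine ⟨hinj i, fun e => ⟨fun h => Set.mem_iUnion.mpr ⟨i, e, h, rfl⟩, fun h => ?_⟩⟩
  obtain ⟨j, e', h', h⟩ := Set.mem_iUnion.mp h
  replace h : mapEdge (duMk G j) e' = mapEdge (duMk G i) e := h
  obtain ⟨x, hx⟩ := exists_mem_of_mem h'
  have hx' := mem_mapEdge (duMk G j) hx
  rw [h] at hx'
  obtain ⟨y, -, hy⟩ := List.mem_map.mp hx'
  obtain rfl : i = j := congrArg (duFst G) hy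
  rwa [← mapEdge_injective (hinj i) h]

/-- A hypergraph is in an additive hereditary property if it is the union of two vertex-disjoint
subhypergraphs in the property. -/
theorem IsAdditiveInducedHereditary.mem_of_two_parts {P : Set (DCHypergraph C)}
    (hP : IsAdditiveInducedHereditary P) {G K L : DCHypergraph C} {a : K.V → G.V} {b : L.V → G.V}
    (ha : IsEmb K G a) (hb : IsEmb L G b) (hcov : ∀ v, v ∈ Set.range b ↔ v ∉ Set.range a)
    (hE : ∀ e ∈ G.E, (∀ x ∈ e.1, x ∈ Set.range a) ∨ (∀ x ∈ e.1, x ∈ Set.range b))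
    (hK : K ∈ P) (hL : L ∈ P) : G ∈ P := by
  classical
  let F : Fin 2 → DCHypergraph C := ![K, L]
  let ι0 : K.V → (disjUnion F).V := duMk F 0
  let ι1 : L.V → (disjUnion F).V := duMk F 1
  have h0 : IsEmb K (disjUnion F) ι0 := isEmb_duMk F 0
  have h1 : IsEmb L (disjUnion F) ι1 := isEmb_duMk F 1
  have h01 : ∀ x y, ι0 x ≠ ι1 y := fun x y h => by
    have : (0 : Fin 2) = 1 := congrArg (duFst F) h
    exact absurd this (by decide)
  -- The inverses of `a` and `b`, glued along the cover of `G` by their ranges.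
  have key : ∀ v, ∃ x, (∃ k, a k = v ∧ x = ι0 k) ∨
      (v ∉ Set.range a ∧ ∃ l, b l = v ∧ x = ι1 l) := by
    intro v
    by_cases hv : v ∈ Set.range a
    · obtain ⟨k, rfl⟩ := hv
      exact ⟨_, Or.inl ⟨k, rfl, rfl⟩⟩
    · obtain ⟨l, rfl⟩ := (hcov v).mpr hv
      exact ⟨_, Or.inr ⟨hv, l, rfl, rfl⟩⟩
  choose f hf using key
  have hfa : ∀ k, f (a k) = ι0 k := by
    intro k
    rcases hf (a k) with ⟨k', hk, h⟩ | ⟨h, -⟩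
    · rw [h, ha.1 hk]
    · exact absurd ⟨k, rfl⟩ h
  have hfb : ∀ v, v ∉ Set.range a → ∃ l, b l = v ∧ f v = ι1 l := by
    intro v hv
    rcases hf v with ⟨k', hk, h⟩ | ⟨-, h⟩
    · exact absurd ⟨k', hk⟩ hv
    · exact h
  have hin : ∀ e, (∀ x ∈ e.1, x ∈ Set.range a) → (e ∈ G.E ↔ mapEdge f e ∈ (disjUnion F).E) := by
    intro e he
    obtain ⟨e, rfl⟩ := exists_mapEdge he
    rw [← ha.2, h0.2, mapEdge_mapEdge, mapEdge_congr (f := f ∘ a)]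
    exact fun x _ => hfa x
  have hout : ∀ e, (∀ x ∈ e.1, x ∉ Set.range a) →
      (e ∈ G.E ↔ mapEdge f e ∈ (disjUnion F).E) := by
    intro e he
    obtain ⟨e, rfl⟩ := exists_mapEdge (f := b) (e := e) fun x hx => (hcov x).mpr (he x hx)
    rw [← hb.2, h1.2, mapEdge_mapEdge, mapEdge_congr (f := f ∘ b)]
    intro x hx
    obtain ⟨l, h, h'⟩ := hfb (b x) (he _ (mem_mapEdge b hx))
    rw [Function.comp, h', hb.1 h]
  refine hP.of_emb (H := disjUnion F) (f := f) ⟨fun x y hxy => ?_, fun e => ?_⟩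
    (hP.isAdditive K L hK hL)
  · rcases hf x with ⟨k, hk, h⟩ | ⟨-, l, hl, h⟩ <;>
      rcases hf y with ⟨k', hk', h'⟩ | ⟨-, l', hl', h'⟩ <;> rw [h, h'] at hxy
    · rw [← hk, ← hk', h0.1 hxy]
    · exact absurd hxy (h01 _ _)
    · exact absurd hxy.symm (h01 _ _)
    · rw [← hl, ← hl', h1.1 hxy]
  · by_cases hA : ∀ x ∈ e.1, x ∈ Set.range a
    · exact hin e hA
    by_cases hB : ∀ x ∈ e.1, x ∉ Set.range a
    · exact hout e hB
    push Not at hA hB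
    obtain ⟨x, hx, hxa⟩ := hA
    obtain ⟨y, hy, k, rfl⟩ := hB
    obtain ⟨l, hl, hfl⟩ := hfb x hxa
    have hno : mapEdge f e ∉ (disjUnion F).E := by
      intro h
      obtain ⟨i, hi⟩ := duFst_eq_of_mem h
      have hx' := hi _ (mem_mapEdge f hx)
      have hy' := hi _ (mem_mapEdge f hy)
      rw [hfl] at hx'
      rw [hfa] at hy'
      have : (0 : Fin 2) = 1 := hy'.trans hx'.symm
      exact absurd this (by decide)
    refine ⟨fun h => ?_, fun h => absurd h hno⟩
    rcases hE e h with h' | h'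
    · exact absurd (h' x hx) hxa
    · exact absurd ⟨k, rfl⟩ ((hcov _).mp (h' _ hy))

theorem IsAdditiveInducedHereditary.mem_of_isEmpty {P : Set (DCHypergraph C)}
    (hP : IsAdditiveInducedHereditary P) {G : DCHypergraph C} (hG : IsEmpty G.V) : G ∈ P := by
  obtain ⟨H, hH⟩ := hP.isProperty.1
  refine hP.of_emb (f := fun v => hG.elim v) ⟨fun v => hG.elim v, ?_⟩ hH
  rintro ⟨_ | ⟨a, l⟩, c⟩
  · exact ⟨fun h => absurd rfl (ne_nil_of_mem h), fun h => absurd rfl (ne_nil_of_mem h)⟩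
  · exact hG.elim a

/-- A hypergraph is in an additive induced-hereditary property if its edges do not cross a
partition all of whose parts induce hypergraphs in the property. -/
theorem IsAdditiveInducedHereditary.mem_of_label {P : Set (DCHypergraph C)}
    (hP : IsAdditiveInducedHereditary P) {G : DCHypergraph C} {I : Type} [Finite I]
    (l : G.V → I) (hl : ∀ e ∈ G.E, ∃ i, ∀ x ∈ e.1, l x = i)
    (h : ∀ i, G.induce (l ⁻¹' {i}) ∈ P) : G ∈ P := by
  classical
  have := Fintype.ofFinite I
  -- Additivity joins two hypergraphs at a time, so the labels are added one by one.
  have key : ∀ S : Finset I, G.induce {v | l v ∈ S} ∈ P := by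
    intro S
    induction S using Finset.induction_on with
    | empty =>
      refine hP.mem_of_isEmpty ⟨fun x => ?_⟩
      have := inVal_mem x
      simp at this
    | insert i S hi ih =>
      set K := G.induce {v | l v ∈ insert i S}
      obtain ⟨a, ha, ha'⟩ := (isEmb_inVal G (l ⁻¹' {i})).exists_codRestrict
        (U := {v | l v ∈ insert i S}) (fun x => by
          have : l _ = i := inVal_mem x
          simp [this])
      obtain ⟨b, hb, hb'⟩ := (isEmb_inVal G {v | l v ∈ S}).exists_codRestrict
        (U := {v | l v ∈ insert i S}) (fun x => by
          have : l _ ∈ S := inVal_mem x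
          simp [this])
      have hK := isEmb_inVal G {v | l v ∈ insert i S}
      have hra : ∀ v : K.V, v ∈ Set.range a ↔ l (inVal G _ v) = i := by
        refine fun v => ⟨?_, fun hv => ?_⟩
        · rintro ⟨x, rfl⟩
          rw [ha']
          exact inVal_mem x
        · obtain ⟨x, hx⟩ := exists_inVal_eq (U := l ⁻¹' {i}) hv
          exact ⟨x, hK.1 (by rw [ha', hx])⟩
      have hrb : ∀ v : K.V, v ∈ Set.range b ↔ l (inVal G _ v) ∈ S := by
        refine fun v => ⟨?_, fun hv => ?_⟩
        · rintro ⟨x, rfl⟩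
          rw [hb']
          exact inVal_mem x
        · obtain ⟨x, hx⟩ := exists_inVal_eq (U := {v | l v ∈ S}) hv
          exact ⟨x, hK.1 (by rw [hb', hx])⟩
      have hcov : ∀ v : K.V, v ∈ Set.range b ↔ v ∉ Set.range a := by
        intro v
        rw [hra, hrb]
        refine ⟨fun hv hv' => hi (hv' ▸ hv), fun hv => ?_⟩
        exact (Finset.mem_insert.mp (inVal_mem v)).resolve_left hv
      refine hP.mem_of_two_parts ha hb hcov (fun e he => ?_) (h i) ih
      obtain ⟨j, hj⟩ := hl _ ((hK.2 e).mp he)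
      rw [forall_mem_mapEdge] at hj
      by_cases hji : j = i
      · exact Or.inl fun x hx => (hra x).mpr ((hj x hx).trans hji)
      · exact Or.inr fun x hx => (hcov x).mpr fun hx' => hji ((hj x hx).symm.trans ((hra x).mp hx'))
  refine hP.of_emb (H := G) (IsEmb.refl G) ?_
  obtain ⟨f, hf, -⟩ := (IsEmb.refl G).exists_codRestrict
    (U := {v | l v ∈ (Finset.univ : Finset I)}) (fun x => Finset.mem_univ _)
  exact hP.of_emb hf (key _)

/-! ### Multiples, joins and decompositions -/

/-- The vertex of `G` below a vertex of a copy of `G`. -/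
def cpVal (k : ℕ) (G : DCHypergraph C) (x : (copies k G).V) : G.V :=
  (show Σ _ : Fin k, G.V from x).2

/-- The index of the copy of `G` containing a vertex. -/
def cpIdx (k : ℕ) (G : DCHypergraph C) (x : (copies k G).V) : Fin k :=
  (show Σ _ : Fin k, G.V from x).1

theorem cp_ext {k : ℕ} {G : DCHypergraph C} {x y : (copies k G).V}
    (h1 : cpIdx k G x = cpIdx k G y) (h2 : cpVal k G x = cpVal k G y) : x = y :=
  Sigma.ext h1 (heq_of_eq h2)

theorem exists_cp {k : ℕ} {G : DCHypergraph C} (i : Fin k) (v : G.V) :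
    ∃ x, cpIdx k G x = i ∧ cpVal k G x = v :=
  ⟨(⟨i, v⟩ : Σ _ : Fin k, G.V), rfl, rfl⟩

theorem mem_copies_iff {k : ℕ} {G : DCHypergraph C} {e : List (copies k G).V × C} :
    e ∈ (copies k G).E ↔ (∃ i, ∀ x ∈ e.1, cpIdx k G x = i) ∧ mapEdge (cpVal k G) e ∈ G.E := by
  have hd := isEmb_duMk (fun _ : Fin k => G)
  constructor
  · intro he
    obtain ⟨i, hi⟩ := duFst_eq_of_mem (G := fun _ : Fin k => G) he
    refine ⟨⟨i, hi⟩, ?_⟩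
    obtain ⟨e', rfl⟩ := exists_mapEdge (f := duMk (fun _ : Fin k => G) i) (e := e) fun x hx =>
      exists_duMk_eq (G := fun _ : Fin k => G) (hi x hx)
    have h1 := ((hd i).2 e').mpr he
    have : mapEdge (cpVal k G) (mapEdge (duMk (fun _ : Fin k => G) i) e') = e' :=
      (mapEdge_mapEdge _ _ _).trans (mapEdge_id e')
    exact this.symm ▸ h1
  · rintro ⟨⟨i, hi⟩, he⟩
    obtain ⟨e', rfl⟩ := exists_mapEdge (f := duMk (fun _ : Fin k => G) i) (e := e) fun x hx =>
      exists_duMk_eq (G := fun _ : Fin k => G) (hi x hx)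
    refine ((hd i).2 e').mp ?_
    have : mapEdge (cpVal k G) (mapEdge (duMk (fun _ : Fin k => G) i) e') = e' :=
      (mapEdge_mapEdge _ _ _).trans (mapEdge_id e')
    exact this ▸ he

/-- A hypergraph `Z` which agrees with the disjoint union of `H₁, …, Hₘ` inside the parts embeds
into a member of `H₁ * ⋯ * Hₘ`. -/
theorem exists_mem_join_isEmb {m : ℕ} (H : Fin m → DCHypergraph C) (Z : DCHypergraph C)
    (s : Z.V → (disjUnion H).V) (hs : Function.Injective s)
    (h : ∀ i, ∀ e : List Z.V × C, (∀ x ∈ e.1, duFst H (s x) = i) →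
      (e ∈ Z.E ↔ mapEdge s e ∈ (disjUnion H).E)) :
    ∃ W ∈ join H, ∃ t : Z.V → W.V, IsEmb Z W t := by
  -- Edges inside a part already come from the disjoint union; only the crossing edges of `Z` are
  -- added.
  let W : DCHypergraph C :=
    { V := (disjUnion H).V
      finite_V := (disjUnion H).finite_V
      E := (disjUnion H).E ∪ mapEdge s '' {e ∈ Z.E | ¬ ∃ i, ∀ x ∈ e.1, duFst H (s x) = i}
      finite_E := (disjUnion H).finite_E.union ((Z.finite_E.subset fun _ he => he.1).image _)
      two_le := by
        rintro e (he | ⟨e, ⟨he, -⟩, rfl⟩)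
        · exact (disjUnion H).two_le e he
        · simpa [mapEdge] using Z.two_le e he
      nodup := by
        rintro e (he | ⟨e, ⟨he, -⟩, rfl⟩)
        · exact (disjUnion H).nodup e he
        · exact (Z.nodup e he).map hs }
  refine ⟨W, ⟨Equiv.refl _, fun i e => ?_⟩, s, hs, fun e => ?_⟩
  · change e ∈ (H i).E ↔ mapEdge (duMk H i) e ∈ W.E
    rw [(isEmb_duMk H i).2]
    refine ⟨Or.inl, ?_⟩
    rintro (he | ⟨e', ⟨-, he⟩, he'⟩)
    · exact he
    · refine absurd ⟨i, ?_⟩ he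
      rw [← forall_mem_mapEdge (f := s) (p := fun x => duFst H x = i), he', forall_mem_mapEdge]
      exact fun x _ => duFst_duMk H i x
  · by_cases hc : ∃ i, ∀ x ∈ e.1, duFst H (s x) = i
    · obtain ⟨i, hi⟩ := hc
      rw [h i e hi]
      refine ⟨Or.inl, ?_⟩
      rintro (he | ⟨e', ⟨-, he⟩, he'⟩)
      · exact he
      · rw [mapEdge_injective hs he'] at he
        exact absurd ⟨i, hi⟩ he
    · refine ⟨fun he => Or.inr ⟨e, ⟨he, hc⟩, rfl⟩, ?_⟩
      rintro (he | ⟨e', ⟨he, -⟩, he'⟩)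
      · obtain ⟨i, hi⟩ := duFst_eq_of_mem he
        exact absurd ⟨i, forall_mem_mapEdge.mp hi⟩ hc
      · rwa [← mapEdge_injective hs he']

section Multiples

variable {G : DCHypergraph C} {m : ℕ}

/-- The hypergraphs `k G[V₁], …, k G[Vₘ]`. -/
def multiples (c : G.V → Fin m) (k : ℕ) (i : Fin m) : DCHypergraph C :=
  copies k (G.induce (c ⁻¹' {i}))

/-- The vertex of `G` below a vertex of `k G[Vᵢ]`. -/
def mulVal (c : G.V → Fin m) (k : ℕ) {i : Fin m} (x : (multiples c k i).V) : G.V :=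
  inVal G _ (cpVal k _ x)

/-- The number of the copy of `G[Vᵢ]` containing a vertex of `k G[Vᵢ]`. -/
def mulIdx (c : G.V → Fin m) (k : ℕ) {i : Fin m} (x : (multiples c k i).V) : Fin k :=
  cpIdx k _ x

theorem mulVal_mem (c : G.V → Fin m) (k : ℕ) {i : Fin m} (x : (multiples c k i).V) :
    c (mulVal c k x) = i :=
  inVal_mem (cpVal k _ x)

theorem mul_ext {c : G.V → Fin m} {k : ℕ} {i : Fin m} {x y : (multiples c k i).V}
    (h1 : mulIdx c k x = mulIdx c k y) (h2 : mulVal c k x = mulVal c k y) : x = y :=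
  cp_ext h1 ((isEmb_inVal G _).1 h2)

theorem exists_mul (c : G.V → Fin m) {k : ℕ} (j : Fin k) (v : G.V) :
    ∃ x : (multiples c k (c v)).V, mulIdx c k x = j ∧ mulVal c k x = v := by
  obtain ⟨y, hy⟩ := exists_inVal_eq (H := G) (U := c ⁻¹' {c v}) (v := v) rfl
  obtain ⟨x, h1, h2⟩ := exists_cp (G := G.induce (c ⁻¹' {c v})) j y
  exact ⟨x, h1, (congrArg (inVal G _) h2).trans hy⟩

theorem mem_multiples_iff {c : G.V → Fin m} {k : ℕ} {i : Fin m}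
    {e : List (multiples c k i).V × C} :
    e ∈ (multiples c k i).E ↔
      (∃ j, ∀ x ∈ e.1, mulIdx c k x = j) ∧ mapEdge (mulVal c k) e ∈ G.E := by
  refine mem_copies_iff.trans (and_congr_right fun _ => ?_)
  exact ((isEmb_inVal G _).2 _).trans (Iff.of_eq (congrArg (· ∈ G.E) (mapEdge_mapEdge _ _ e)))

/-- `Z` is an induced subhypergraph of a member of `k G[V₁] * ⋯ * k G[Vₘ]`, where the vertex `x`
is in the copy with the number `l x` of the vertex `p x` of `G`. -/
structure IsSubMultiple (c : G.V → Fin m) {k : ℕ} (Z : DCHypergraph C) (p : Z.V → G.V)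
    (l : Z.V → Fin k) : Prop where
  ext : ∀ x y, p x = p y → l x = l y → x = y
  mem_iff : ∀ i, ∀ e : List Z.V × C, (∀ x ∈ e.1, c (p x) = i) →
    (e ∈ Z.E ↔ (∃ j, ∀ x ∈ e.1, l x = j) ∧ mapEdge p e ∈ G.E)

/-- `Z` need not use all vertices of the multiples: it is completed to a member of the join by
`exists_mem_join_isEmb`, and heredity leads back to `Z`. -/
theorem IsDecomposition.mem_of_isSubMultiple {P : Set (DCHypergraph C)}
    (hP : IsAdditiveInducedHereditary P) {c : G.V → Fin m} (hc : IsDecomposition P G c) {k : ℕ}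
    (hk : 1 ≤ k) {Z : DCHypergraph C} {p : Z.V → G.V} {l : Z.V → Fin k}
    (hZ : IsSubMultiple c Z p l) : Z ∈ P := by
  choose s hs1 hs2 using fun x => exists_mul c (l x) (p x)
  let t : Z.V → (disjUnion (multiples c k)).V := fun x => duMk _ (c (p x)) (s x)
  have hts : ∀ x i, c (p x) = i →
      ∃ y, t x = duMk (multiples c k) i y ∧ mulIdx c k y = l x ∧ mulVal c k y = p x := by
    rintro x i rfl
    exact ⟨s x, rfl, hs1 x, hs2 x⟩
  suffices h : ∃ W ∈ join (multiples c k), ∃ u : Z.V → W.V, IsEmb Z W u by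
    obtain ⟨W, hW, u, hu⟩ := h
    exact hP.of_emb hu (hc.2 k hk hW)
  refine exists_mem_join_isEmb (multiples c k) Z t (fun x y hxy => ?_) (fun i e he => ?_)
  · have hi : c (p x) = c (p y) := congrArg (duFst _) hxy
    obtain ⟨x', hx, hx1, hx2⟩ := hts x (c (p y)) hi
    obtain ⟨y', hy, hy1, hy2⟩ := hts y (c (p y)) rfl
    rw [hx, hy] at hxy
    obtain rfl := (isEmb_duMk _ _).1 hxy
    exact hZ.ext x y (hx2.symm.trans hy2) (hx1.symm.trans hy1)
  · replace he : ∀ x ∈ e.1, c (p x) = i := he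
    obtain ⟨e', he'⟩ := exists_mapEdge (f := duMk (multiples c k) i) (e := mapEdge t e) (by
      rw [forall_mem_mapEdge]
      intro x hx
      obtain ⟨y, hy, -⟩ := hts x i (he x hx)
      exact ⟨y, hy.symm⟩)
    let q : (disjUnion (multiples c k)).V → G.V := fun x =>
      mulVal c k (show Σ i, (multiples c k i).V from x).2
    let r : (disjUnion (multiples c k)).V → Fin k := fun x =>
      mulIdx c k (show Σ i, (multiples c k i).V from x).2
    have hq : mapEdge (mulVal c k) e' = mapEdge p e := by
      have h1 : mapEdge q (mapEdge (duMk (multiples c k) i) e') = mapEdge (mulVal c k) e' :=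
        mapEdge_mapEdge _ _ _
      rw [← h1, he', mapEdge_mapEdge]
      exact mapEdge_congr fun x _ => hs2 x
    have hr : mapEdge (mulIdx c k) e' = mapEdge l e := by
      have h1 : mapEdge r (mapEdge (duMk (multiples c k) i) e') = mapEdge (mulIdx c k) e' :=
        mapEdge_mapEdge _ _ _
      rw [← h1, he', mapEdge_mapEdge]
      exact mapEdge_congr fun x _ => hs1 x
    rw [hZ.mem_iff i e he, ← he', ← (isEmb_duMk _ i).2, mem_multiples_iff, hq]
    refine and_congr_left fun _ => exists_congr fun j => ?_
    rw [← forall_mem_mapEdge (f := l) (p := (· = j)), ← hr, forall_mem_mapEdge]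

/-- The bad member of the join is itself a submultiple, with vertex and copy number read off through
its labelling. This is the only form in which failed decompositions are used. -/
theorem exists_isSubMultiple_of_not_isDecomposition {P : Set (DCHypergraph C)} {c : G.V → Fin m}
    (hc : Function.Surjective c) (h : ¬ IsDecomposition P G c) :
    ∃ (k : ℕ) (Z : DCHypergraph C) (p : Z.V → G.V) (l : Z.V → Fin k),
      1 ≤ k ∧ IsSubMultiple c Z p l ∧ Z ∉ P := by
  have : ∃ k, 1 ≤ k ∧ ¬ join (multiples c k) ⊆ P := by
    by_contra! h'
    exact h ⟨hc, h'⟩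
  obtain ⟨k, hk1, hk⟩ := this
  obtain ⟨Z, ⟨f, hf⟩, hZ⟩ := Set.not_subset.mp hk
  let q : (Σ i, (multiples c k i).V) → G.V := fun x => mulVal c k x.2
  let r : (Σ i, (multiples c k i).V) → Fin k := fun x => mulIdx c k x.2
  have hq : ∀ x, c (q x) = x.1 := fun x => mulVal_mem c k x.2
  have hqr : ∀ x y, q x = q y → r x = r y → x = y := by
    rintro ⟨i, a⟩ ⟨j, b⟩ h1 h2
    obtain rfl : i = j := by
      rw [← mulVal_mem c k a, ← mulVal_mem c k b]
      exact congrArg c h1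
    exact congrArg (Sigma.mk i) (mul_ext h2 h1)
  refine ⟨k, Z, fun x => q (f.symm x), fun x => r (f.symm x), hk1,
    ⟨fun x y h1 h2 => f.symm.injective (hqr _ _ h1 h2), fun i e he => ?_⟩, hZ⟩
  obtain ⟨e, rfl⟩ := exists_mapEdge (f := fun v => f ⟨i, v⟩) (e := e) fun x hx => by
    have h1 := he x hx
    rw [hq] at h1
    subst h1
    exact ⟨_, f.apply_symm_apply x⟩
  refine (hf i e).symm.trans (mem_multiples_iff.trans ?_)
  have h1 : ∀ v, f.symm (f ⟨i, v⟩) = ⟨i, v⟩ := fun v => f.symm_apply_apply _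
  rw [mapEdge_mapEdge, mapEdge_congr (f := (fun x => q (f.symm x)) ∘ fun v => f ⟨i, v⟩)
    (g := mulVal c k) fun x _ => by rw [Function.comp, h1]]
  simp only [forall_mem_mapEdge, h1]
  rfl

end Multiples

/-! ### Patterns and their vertex Ramsey property -/

/-- A finite set of coloured tuples of `V × I`, for a finite index set `I`, each of which meets
several copies of `V` and several classes of the partition `U` of `V`. -/
structure Pattern (C : Type u) {V κ : Type} (U : V → κ) where
  I : Type
  finite_I : Finite I
  E : Set (List (V × I) × C)
  finite_E : E.Finite
  nodup : ∀ e ∈ E, e.1.Nodup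
  crosses_copies : ∀ e ∈ E, ∃ x ∈ e.1, ∃ y ∈ e.1, x.2 ≠ y.2
  crosses_parts : ∀ e ∈ E, ∃ x ∈ e.1, ∃ y ∈ e.1, U x.1 ≠ U y.1

namespace Pattern

variable {V κ : Type} {U : V → κ}

/-- An embedding of patterns, as a map of the index sets. -/
def IsEmb (Q R : Pattern C U) (φ : Q.I → R.I) : Prop :=
  Function.Injective φ ∧ ∀ e, e ∈ Q.E ↔ mapEdge (Prod.map id φ) e ∈ R.E

theorem IsEmb.comp {Q R S : Pattern C U} {φ : Q.I → R.I} {ψ : R.I → S.I} (hψ : R.IsEmb S ψ)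
    (hφ : Q.IsEmb R φ) : Q.IsEmb S (ψ ∘ φ) :=
  ⟨hψ.1.comp hφ.1, fun e => by rw [hφ.2, hψ.2, mapEdge_mapEdge, Prod.map_comp_map]; rfl⟩

/-- The lexicographic product of two patterns. -/
@[reducible]
def lex [Finite V] (Q R : Pattern C U) : Pattern C U where
  I := Q.I × R.I
  finite_I := by
    have := Q.finite_I
    have := R.finite_I
    infer_instance
  -- Every tuple projecting to an edge of `Q` is an edge, and each row `{i} × R.I` carries a copy of
  -- `R`.
  E := mapEdge (Prod.map id Prod.fst) ⁻¹' Q.E ∪ ⋃ i, mapEdge (Prod.map id (Prod.mk i)) '' R.E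
  finite_E := by
    have := Q.finite_I
    have := R.finite_I
    refine Set.Finite.union (Q.finite_E.preimage' fun e _ => ?_)
      (Set.finite_iUnion fun i => R.finite_E.image _)
    -- All lifts of a tuple have its length, over a finite alphabet.
    refine ((List.finite_length_eq (V × Q.I × R.I) e.1.length).prod
      (Set.finite_singleton e.2)).subset ?_
    rintro e' rfl
    simp [mapEdge]
  nodup := by
    rintro e (he | he)
    · exact List.Nodup.of_map _ (Q.nodup _ he)
    · obtain ⟨i, e, he', rfl⟩ := Set.mem_iUnion.mp he
      exact (R.nodup _ he').map (Function.injective_id.prodMap (Prod.mk_right_injective i))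
  crosses_copies := by
    rintro e (he | he)
    · obtain ⟨x, hx, y, hy, h⟩ := Q.crosses_copies _ he
      obtain ⟨x, hx', rfl⟩ := List.mem_map.mp hx
      obtain ⟨y, hy', rfl⟩ := List.mem_map.mp hy
      exact ⟨x, hx', y, hy', fun h' => h (congrArg Prod.fst h')⟩
    · obtain ⟨i, e, he', rfl⟩ := Set.mem_iUnion.mp he
      obtain ⟨x, hx, y, hy, h⟩ := R.crosses_copies _ he'
      exact ⟨_, mem_mapEdge _ hx, _, mem_mapEdge _ hy, fun h' => h (Prod.ext_iff.mp h').2⟩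
  crosses_parts := by
    rintro e (he | he)
    · obtain ⟨x, hx, y, hy, h⟩ := Q.crosses_parts _ he
      obtain ⟨x, hx', rfl⟩ := List.mem_map.mp hx
      obtain ⟨y, hy', rfl⟩ := List.mem_map.mp hy
      exact ⟨x, hx', y, hy', h⟩
    · obtain ⟨i, e, he', rfl⟩ := Set.mem_iUnion.mp he
      obtain ⟨x, hx, y, hy, h⟩ := R.crosses_parts _ he'
      exact ⟨_, mem_mapEdge _ hx, _, mem_mapEdge _ hy, h⟩

/-- Lifted edges of `Q` meet at least two rows, so inside one row only `R` is visible. -/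
theorem isEmb_lex_row [Finite V] (Q R : Pattern C U) (i : Q.I) :
    R.IsEmb (Q.lex R) (Prod.mk i) := by
  refine ⟨Prod.mk_right_injective i, fun e => ⟨fun he =>
    Or.inr (Set.mem_iUnion.mpr ⟨i, e, he, rfl⟩), ?_⟩⟩
  rintro (he | he)
  · obtain ⟨x, hx, y, hy, h⟩ := Q.crosses_copies _ he
    rw [mapEdge_mapEdge] at hx hy
    obtain ⟨x, -, rfl⟩ := List.mem_map.mp hx
    obtain ⟨y, -, rfl⟩ := List.mem_map.mp hy
    exact absurd rfl h
  · obtain ⟨j, e', he', h⟩ := Set.mem_iUnion.mp he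
    obtain ⟨x, hx, -⟩ := R.crosses_copies _ he'
    have hx' := mem_mapEdge (Prod.map id (Prod.mk j)) hx
    rw [h] at hx'
    obtain ⟨y, -, hy⟩ := List.mem_map.mp hx'
    obtain rfl : i = j := congrArg (fun z => z.2.1) hy
    rwa [← mapEdge_injective (Function.injective_id.prodMap (Prod.mk_right_injective i)) h]

/-- A transversal meets each row in one index, while edges of `R` meet two; so only lifts of edges
of `Q` are visible. -/
theorem isEmb_lex_transversal [Finite V] (Q R : Pattern C U) (j : Q.I → R.I) :
    Q.IsEmb (Q.lex R) (fun i => (i, j i)) := by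
  have hid : ∀ e : List (V × Q.I) × C,
      mapEdge (Prod.map id Prod.fst) (mapEdge (Prod.map id fun i => (i, j i)) e) = e := by
    intro e
    rw [mapEdge_mapEdge]
    exact mapEdge_id e
  refine ⟨fun x y h => congrArg Prod.fst h, fun e => ⟨fun he => Or.inl ?_, ?_⟩⟩
  · rw [Set.mem_preimage]
    exact (hid e).symm ▸ he
  · rintro (he | he)
    · rw [Set.mem_preimage] at he
      exact hid e ▸ he
    · obtain ⟨i, e', he', h⟩ := Set.mem_iUnion.mp he
      obtain ⟨x, hx, y, hy, hxy⟩ := R.crosses_copies _ he'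
      have hx' := mem_mapEdge (Prod.map id (Prod.mk i)) hx
      have hy' := mem_mapEdge (Prod.map id (Prod.mk i)) hy
      rw [h] at hx' hy'
      obtain ⟨a, -, ha⟩ := List.mem_map.mp hx'
      obtain ⟨b, -, hb⟩ := List.mem_map.mp hy'
      have ha1 : a.2 = i := congrArg (fun z => z.2.1) ha
      have hb1 : b.2 = i := congrArg (fun z => z.2.1) hb
      have ha2 : j a.2 = x.2 := congrArg (fun z => z.2.2) ha
      have hb2 : j b.2 = y.2 := congrArg (fun z => z.2.2) hb
      rw [ha1] at ha2
      rw [hb1] at hb2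
      exact absurd (ha2.symm.trans hb2) hxy

/-- The vertex partition property of patterns: given a pattern for every type in a finite set `S`,
there is a pattern such that every assignment of types in `S` to the indices contains a
monochromatic copy of the pattern of its type. -/
theorem exists_monochromatic [Finite V] {T : Type*} (F : T → Pattern C U) (S : Finset T) :
    ∃ Q : Pattern C U, ∀ t : Q.I → T, (∀ i, t i ∈ S) →
      ∃ f ∈ S, ∃ φ : (F f).I → Q.I, (F f).IsEmb Q φ ∧ ∀ i, t (φ i) = f := by
  classical
  induction S using Finset.induction_on with
  | empty =>
    -- The index set must be nonempty: then no assignment of types from the empty set exists.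
    exact ⟨⟨Unit, inferInstance, ∅, Set.finite_empty, by simp, by simp, by simp⟩,
      fun t ht => absurd (ht ()) (by simp)⟩
  | insert f S hf ih =>
    obtain ⟨R, hR⟩ := ih
    refine ⟨(F f).lex R, fun t ht => ?_⟩
    -- Either some row avoids the type `f` and induction applies inside it, or every row has an
    -- index of type `f` and these form a transversal.
    by_cases h : ∃ i, ∀ j, t (i, j) ∈ S
    · obtain ⟨i, hi⟩ := h
      obtain ⟨g, hg, φ, hφ, hφt⟩ := hR (fun j => t (i, j)) hi
      exact ⟨g, Finset.mem_insert_of_mem hg, _, (isEmb_lex_row (F f) R i).comp hφ, hφt⟩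
    · push Not at h
      choose j hj using h
      exact ⟨f, Finset.mem_insert_self f S, _, isEmb_lex_transversal (F f) R j,
        fun i => (Finset.mem_insert.mp (ht (i, j i))).resolve_right (hj i)⟩

end Pattern

/-! ### Blow-ups of a hypergraph by a pattern -/

variable {G : DCHypergraph C} {κ : Type} {U : G.V → κ}

/-- The hypergraph formed by disjoint copies of `G` and the edges of a pattern between them. -/
def blowUp (G : DCHypergraph C) {κ : Type} {U : G.V → κ} (Q : Pattern C U) : DCHypergraph C where
  V := G.V × Q.I
  finite_V := by
    have := G.finite_V
    have := Q.finite_I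
    infer_instance
  E := Q.E ∪ ⋃ i, mapEdge (fun v => (v, i)) '' G.E
  finite_E := by
    have := Q.finite_I
    exact Q.finite_E.union (Set.finite_iUnion fun i => G.finite_E.image _)
  two_le := by
    rintro e (he | he)
    · obtain ⟨x, hx, y, hy, h⟩ := Q.crosses_copies _ he
      by_contra! hlt
      have h1 : e.1.length = 1 := by
        have := List.length_pos_of_mem hx
        omega
      obtain ⟨a, ha⟩ := List.length_eq_one_iff.mp h1
      rw [ha, List.mem_singleton] at hx hy
      exact h (by rw [hx, hy])
    · obtain ⟨i, e, he', rfl⟩ := Set.mem_iUnion.mp he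
      simpa [mapEdge] using G.two_le _ he'
  nodup := by
    rintro e (he | he)
    · exact Q.nodup e he
    · obtain ⟨i, e, he', rfl⟩ := Set.mem_iUnion.mp he
      exact (G.nodup _ he').map (Prod.mk_left_injective i)

/-- The vertex of `blowUp G Q` over `v` in the copy `i`. -/
def buMk (Q : Pattern C U) (i : Q.I) (v : G.V) : (blowUp G Q).V := (v, i)

/-- The vertex of `G` below a vertex of `blowUp G Q`. -/
def buVal (Q : Pattern C U) (x : (blowUp G Q).V) : G.V := Prod.fst x

/-- The index of the copy of `G` containing a vertex of `blowUp G Q`. -/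
def buIdx (Q : Pattern C U) (x : (blowUp G Q).V) : Q.I := Prod.snd x

theorem isEmb_buMk (Q : Pattern C U) (i : Q.I) : IsEmb G (blowUp G Q) (buMk Q i) := by
  have hinj : ∀ i, Function.Injective (buMk Q i) := fun i x y h => congrArg (buVal Q) h
  refine ⟨hinj i, fun e => ⟨fun he => Or.inr (Set.mem_iUnion.mpr ⟨i, e, he, rfl⟩), ?_⟩⟩
  rintro (he | he)
  · obtain ⟨x, hx, y, hy, h⟩ := Q.crosses_copies _ he
    obtain ⟨x, -, rfl⟩ := List.mem_map.mp hx
    obtain ⟨y, -, rfl⟩ := List.mem_map.mp hy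
    exact absurd rfl h
  · obtain ⟨j, e', he', h⟩ := Set.mem_iUnion.mp he
    replace h : mapEdge (buMk Q j) e' = mapEdge (buMk Q i) e := h
    obtain ⟨x, hx⟩ := exists_mem_of_mem he'
    have hx' := mem_mapEdge (buMk Q j) hx
    rw [h] at hx'
    obtain ⟨y, -, hy⟩ := List.mem_map.mp hx'
    obtain rfl : i = j := congrArg (buIdx Q) hy
    rwa [← mapEdge_injective (hinj i) h]

theorem mem_blowUp_of_idx_eq {Q : Pattern C U} {i : Q.I} {e : List (blowUp G Q).V × C}
    (he : ∀ x ∈ e.1, buIdx Q x = i) : e ∈ (blowUp G Q).E ↔ mapEdge (buVal Q) e ∈ G.E := by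
  rw [(isEmb_buMk Q i).2, mapEdge_mapEdge]
  have h : mapEdge (buMk Q i ∘ buVal Q) e = mapEdge id e :=
    mapEdge_congr fun x hx => Prod.ext rfl (he x hx).symm
  rw [h, mapEdge_id]

theorem mem_blowUp_of_ne {Q : Pattern C U} {e : List (blowUp G Q).V × C}
    (he : ∃ x ∈ e.1, ∃ y ∈ e.1, buIdx Q x ≠ buIdx Q y) : e ∈ (blowUp G Q).E ↔ e ∈ Q.E := by
  refine ⟨?_, Or.inl⟩
  rintro (h | h)
  · exact h
  · obtain ⟨i, e, -, rfl⟩ := Set.mem_iUnion.mp h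
    obtain ⟨x, hx, y, hy, h⟩ := he
    obtain ⟨x, -, rfl⟩ := List.mem_map.mp hx
    obtain ⟨y, -, rfl⟩ := List.mem_map.mp hy
    exact absurd rfl h

/-- Inside one class of `U` no pattern edge survives, so the copies of `G` there are disconnected
from each other. -/
theorem exists_idx_eq_of_mem_blowUp {Q : Pattern C U} {e : List (blowUp G Q).V × C}
    (he : e ∈ (blowUp G Q).E) {a : κ} (ha : ∀ x ∈ e.1, U (buVal Q x) = a) :
    ∃ i, ∀ x ∈ e.1, buIdx Q x = i := by
  rcases he with h | h
  · obtain ⟨x, hx, y, hy, h⟩ := Q.crosses_parts _ h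
    exact absurd ((ha x hx).trans (ha y hy).symm) h
  · obtain ⟨i, e, -, rfl⟩ := Set.mem_iUnion.mp h
    exact ⟨i, forall_mem_mapEdge.mpr fun _ _ => rfl⟩

theorem Pattern.IsEmb.isEmb_blowUp {Q R : Pattern C U} {φ : Q.I → R.I} (hφ : Q.IsEmb R φ) :
    DCHypergraph.IsEmb (blowUp G Q) (blowUp G R) (fun x => buMk R (φ (buIdx Q x)) (buVal Q x)) := by
  refine ⟨fun x y h => Prod.ext (congrArg (buVal R) h) (hφ.1 (congrArg (buIdx R) h)), fun e => ?_⟩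
  by_cases he : ∃ x ∈ e.1, ∃ y ∈ e.1, buIdx Q x ≠ buIdx Q y
  · rw [mem_blowUp_of_ne he, mem_blowUp_of_ne]
    · exact hφ.2 e
    · obtain ⟨x, hx, y, hy, h⟩ := he
      exact ⟨_, mem_mapEdge _ hx, _, mem_mapEdge _ hy, fun h' => h (hφ.1 h')⟩
  · push Not at he
    by_cases hn : e.1 = []
    · exact ⟨fun h => absurd hn (ne_nil_of_mem h), fun h => absurd (by simp [mapEdge, hn])
        (ne_nil_of_mem h)⟩
    · obtain ⟨x, hx⟩ := List.exists_mem_of_ne_nil _ hn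
      rw [mem_blowUp_of_idx_eq (i := buIdx Q x) fun y hy => he y hy x hx,
        mem_blowUp_of_idx_eq (i := φ (buIdx Q x)), mapEdge_mapEdge]
      · rfl
      · rw [forall_mem_mapEdge]
        exact fun y hy => congrArg φ (he y hy x hx)

/-- The copies of `G` in `blowUp G Q` may be coloured like `G`, if the colour classes are the
classes of the partition which the edges of the pattern cross. -/
theorem blowUp_induce_mem {P : Set (DCHypergraph C)} (hP : IsAdditiveInducedHereditary P)
    (Q : Pattern C U) {a : κ} (h : G.induce (U ⁻¹' {a}) ∈ P) :
    (blowUp G Q).induce ((fun x => U (buVal Q x)) ⁻¹' {a}) ∈ P := by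
  have := Q.finite_I
  have hv := isEmb_inVal (blowUp G Q) ((fun x => U (buVal Q x)) ⁻¹' {a})
  have hmem : ∀ x, U (buVal Q (inVal (blowUp G Q) ((fun x => U (buVal Q x)) ⁻¹' {a}) x)) = a :=
    fun x => inVal_mem x
  -- The colour class is a disjoint union over the copies, each a copy of the colour class in `G`.
  refine hP.mem_of_label (fun x => buIdx Q (inVal _ _ x)) (fun e he => ?_) (fun i => ?_)
  · obtain ⟨i, hi⟩ := exists_idx_eq_of_mem_blowUp ((hv.2 e).mp he)
      (forall_mem_mapEdge.mpr fun x _ => hmem x)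
    exact ⟨i, forall_mem_mapEdge.mp hi⟩
  · refine hP.induce_mem_induce h (f := fun x => buVal Q (inVal _ _ x)) (fun x _ => hmem x)
      (fun x hx y hy hxy => hv.1 (Prod.ext hxy (hx.trans hy.symm))) (fun e he => ?_)
    rw [hv.2, mem_blowUp_of_idx_eq (forall_mem_mapEdge.mpr he), mapEdge_mapEdge]
    rfl

/-- A hypergraph `Z` outside the product of the `Bᵢ`, which is a subhypergraph of a member of the
join of multiples of the classes `(U, f)`, yields a pattern whose copies of `G` cannot all be
coloured by `f`. -/
theorem exists_pattern_of_isSubMultiple {m n k : ℕ} {c : G.V → Fin m} {f : G.V → Fin n}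
    (hcU : ∀ x y, c x = c y ↔ U x = U y ∧ f x = f y) {B : Fin n → Set (DCHypergraph C)}
    (hB : ∀ i, IsAdditiveInducedHereditary (B i)) {Z : DCHypergraph C} {p : Z.V → G.V}
    {l : Z.V → Fin k} (hZ : IsSubMultiple c Z p l) (hZB : Z ∉ product B) :
    ∃ Q : Pattern C U,
      ¬ ∀ i, (blowUp G Q).induce ((fun x => f (buVal Q x)) ⁻¹' {i}) ∈ B i := by
  -- The copy index records the refined class as well as the copy number; hence vertices in
  -- different classes of `U` lie in different copies, as `crosses_copies` requires.
  let ι : Z.V → G.V × (Fin m × Fin k) := fun x => (p x, (c (p x), l x))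
  have hι : Function.Injective ι := fun x y h =>
    hZ.ext x y (congrArg Prod.fst h) (congrArg (fun z => z.2.2) h)
  let Q : Pattern C U :=
    { I := Fin m × Fin k
      finite_I := inferInstance
      E := mapEdge ι '' {e ∈ Z.E | ∃ x ∈ e.1, ∃ y ∈ e.1, U (p x) ≠ U (p y)}
      finite_E := (Z.finite_E.subset fun _ he => he.1).image _
      nodup := by
        rintro _ ⟨e, ⟨he, -⟩, rfl⟩
        exact (Z.nodup e he).map hι
      crosses_copies := by
        rintro _ ⟨e, ⟨he, x, hx, y, hy, h⟩, rfl⟩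
        exact ⟨_, mem_mapEdge ι hx, _, mem_mapEdge ι hy,
          fun h' => h ((hcU _ _).mp (congrArg Prod.fst h')).1⟩
      crosses_parts := by
        rintro _ ⟨e, ⟨he, x, hx, y, hy, h⟩, rfl⟩
        exact ⟨_, mem_mapEdge ι hx, _, mem_mapEdge ι hy, h⟩ }
  refine ⟨Q, fun h => hZB ⟨fun x => f (p x), fun b => ?_⟩⟩
  let j : Z.V → (blowUp G Q).V := fun x => buMk Q (c (p x), l x) (p x)
  refine (hB b).induce_mem_induce (h b) (f := j) (fun x hx => hx) hι.injOn (fun e he => ?_)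
  by_cases hU : ∃ x ∈ e.1, ∃ y ∈ e.1, U (p x) ≠ U (p y)
  · rw [mem_blowUp_of_ne]
    · refine ⟨fun h => ⟨e, ⟨h, hU⟩, rfl⟩, ?_⟩
      rintro ⟨e', ⟨h, -⟩, he'⟩
      rwa [← mapEdge_injective hι he']
    · obtain ⟨x, hx, y, hy, h⟩ := hU
      exact ⟨_, mem_mapEdge j hx, _, mem_mapEdge j hy,
        fun h' => h ((hcU _ _).mp (congrArg Prod.fst h')).1⟩
  -- Inside one class of `U` and one class of `f`, the tuple lies in a single class of `c`, where
  -- `Z` looks like copies of `G`.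
  · push Not at hU
    by_cases hn : e.1 = []
    · exact ⟨fun h => absurd hn (ne_nil_of_mem h), fun h => absurd (by simp [mapEdge, hn])
        (ne_nil_of_mem h)⟩
    obtain ⟨x, hx⟩ := List.exists_mem_of_ne_nil _ hn
    have hc : ∀ y ∈ e.1, c (p y) = c (p x) := fun y hy =>
      (hcU _ _).mpr ⟨hU y hy x hx, (he y hy).trans (he x hx).symm⟩
    rw [hZ.mem_iff _ e hc]
    constructor
    · rintro ⟨⟨a, ha⟩, h⟩
      rw [mem_blowUp_of_idx_eq (i := (c (p x), a)), mapEdge_mapEdge]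
      · exact h
      · rw [forall_mem_mapEdge]
        exact fun y hy => Prod.ext (hc y hy) (ha y hy)
    · intro h
      obtain ⟨i, hi⟩ := exists_idx_eq_of_mem_blowUp h (a := U (p x))
        (forall_mem_mapEdge.mpr fun y hy => hU y hy x hx)
      rw [mem_blowUp_of_idx_eq hi, mapEdge_mapEdge] at h
      rw [forall_mem_mapEdge] at hi
      exact ⟨⟨i.2, fun y hy => congrArg Prod.snd (hi y hy)⟩, h⟩

/-- If `L` and `K` embed into `G` and every vertex of `L` is a vertex of `K[W]`, then `L` is in
every hereditary property that contains `K[W]`. -/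
theorem IsAdditiveInducedHereditary.mem_of_isEmb {P : Set (DCHypergraph C)}
    (hP : IsAdditiveInducedHereditary P) {K L G : DCHypergraph C} {g : K.V → G.V} {h : L.V → G.V}
    (hg : IsEmb K G g) (hh : IsEmb L G h) {W : Set K.V} (hW : K.induce W ∈ P)
    (hcov : ∀ z, ∃ x ∈ W, g x = h z) : L ∈ P := by
  choose s hsW hs using hcov
  have h1 : IsEmb L K s := by
    refine ⟨fun x y hxy => hh.1 (by rw [← hs, ← hs, hxy]), fun e => ?_⟩
    rw [hh.2, hg.2, mapEdge_mapEdge, mapEdge_congr]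
    exact fun x _ => (hs x).symm
  obtain ⟨t, ht, -⟩ := h1.exists_codRestrict hsW
  exact hP.of_emb ht hW

theorem IsAdditiveInducedHereditary.induce_mem_of_isEmb {P : Set (DCHypergraph C)}
    (hP : IsAdditiveInducedHereditary P) {K G : DCHypergraph C} {g : K.V → G.V}
    (hg : IsEmb K G g) {W : Set K.V} {U : Set G.V} (hW : K.induce W ∈ P)
    (hcov : ∀ y ∈ U, ∃ x ∈ W, g x = y) : G.induce U ∈ P :=
  hP.mem_of_isEmb hg (isEmb_inVal G U) hW fun z => hcov _ (inVal_mem z)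

/-! ### Disjoint sums of two coloured hypergraphs -/

/-- `Y` is a disjoint union of `G` and `K`, with inclusions `a` and `b`. -/
structure IsDisjSum (G K Y : DCHypergraph C) (a : G.V → Y.V) (b : K.V → Y.V) : Prop where
  left : IsEmb G Y a
  right : IsEmb K Y b
  cover : ∀ v, v ∈ Set.range b ↔ v ∉ Set.range a
  edge : ∀ e ∈ Y.E, (∀ x ∈ e.1, x ∈ Set.range a) ∨ (∀ x ∈ e.1, x ∈ Set.range b)

theorem exists_isDisjSum (G K : DCHypergraph C) :
    ∃ (Y : DCHypergraph C) (a : G.V → Y.V) (b : K.V → Y.V), IsDisjSum G K Y a b := by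
  let F : Fin 2 → DCHypergraph C := ![G, K]
  let a : G.V → (disjUnion F).V := duMk F 0
  let b : K.V → (disjUnion F).V := duMk F 1
  have hra : ∀ v, v ∈ Set.range a ↔ duFst F v = 0 := by
    refine fun v => ⟨?_, fun hv => ?_⟩
    · rintro ⟨x, rfl⟩
      exact duFst_duMk F 0 x
    · exact exists_duMk_eq hv
  have hrb : ∀ v, v ∈ Set.range b ↔ duFst F v = 1 := by
    refine fun v => ⟨?_, fun hv => ?_⟩
    · rintro ⟨x, rfl⟩
      exact duFst_duMk F 1 x
    · exact exists_duMk_eq hv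
  refine ⟨disjUnion F, a, b, isEmb_duMk F 0, isEmb_duMk F 1, fun v => ?_, fun e he => ?_⟩
  · rw [hra, hrb]
    omega
  · obtain ⟨i, hi⟩ := duFst_eq_of_mem he
    by_cases h : i = 0
    · exact Or.inl fun x hx => (hra x).mpr ((hi x hx).trans h)
    · exact Or.inr fun x hx => (hrb x).mpr ((hi x hx).trans (by omega))

theorem IsDisjSum.mem {P : Set (DCHypergraph C)} (hP : IsAdditiveInducedHereditary P)
    {G K Y : DCHypergraph C} {a : G.V → Y.V} {b : K.V → Y.V} (h : IsDisjSum G K Y a b)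
    (hG : G ∈ P) (hK : K ∈ P) : Y ∈ P :=
  hP.mem_of_two_parts h.left h.right h.cover h.edge hG hK

/-- Colourings of `G` and `K` combine to a colouring of their disjoint union. -/
theorem IsDisjSum.exists_colouring {n : ℕ} {A : Fin n → Set (DCHypergraph C)}
    (hA : ∀ i, IsAdditiveInducedHereditary (A i)) {G K Y : DCHypergraph C} {a : G.V → Y.V}
    {b : K.V → Y.V} (h : IsDisjSum G K Y a b) {U : G.V → Fin n} {W : K.V → Fin n}
    (hU : ∀ i, G.induce (U ⁻¹' {i}) ∈ A i) (hW : ∀ i, K.induce (W ⁻¹' {i}) ∈ A i) :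
    ∃ c : Y.V → Fin n, (∀ i, Y.induce (c ⁻¹' {i}) ∈ A i) ∧ (∀ x, c (a x) = U x) ∧
      ∀ x, c (b x) = W x := by
  have key : ∀ y, ∃ i, (∀ x, a x = y → U x = i) ∧ ∀ x, b x = y → W x = i := by
    intro y
    by_cases hy : y ∈ Set.range a
    · obtain ⟨x, rfl⟩ := hy
      refine ⟨U x, fun x' hx' => by rw [h.left.1 hx'], fun x' hx' => ?_⟩
      exact absurd ⟨x, rfl⟩ ((h.cover _).mp ⟨x', hx'⟩)
    · obtain ⟨x, rfl⟩ := (h.cover y).mpr hy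
      exact ⟨W x, fun x' hx' => absurd ⟨x', hx'⟩ hy, fun x' hx' => by rw [h.right.1 hx']⟩
  choose c hca hcb using key
  refine ⟨c, fun i => ?_, fun x => (hca _ x rfl).symm, fun x => (hcb _ x rfl).symm⟩
  have hv := isEmb_inVal Y (c ⁻¹' {i})
  have hci : ∀ x, c (inVal Y (c ⁻¹' {i}) x) = i := fun x => inVal_mem x
  -- The two labels say whether a vertex comes from `G`.
  refine (hA i).mem_of_label (I := Prop) (fun x => inVal Y _ x ∈ Set.range a) (fun e he => ?_)
    (fun p => ?_)
  · rcases h.edge _ ((hv.2 e).mp he) with h' | h'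
    · exact ⟨True, fun x hx => eq_true (forall_mem_mapEdge.mp h' x hx)⟩
    · exact ⟨False, fun x hx => eq_false ((h.cover _).mp (forall_mem_mapEdge.mp h' x hx))⟩
  · have hv' := isEmb_inVal (Y.induce (c ⁻¹' {i})) ((fun x => inVal Y _ x ∈ Set.range a) ⁻¹' {p})
    have hp : ∀ x, (inVal Y (c ⁻¹' {i}) (inVal _ ((fun x => inVal Y _ x ∈ Set.range a) ⁻¹' {p}) x)
      ∈ Set.range a) = p := fun x => inVal_mem x
    by_cases hp' : p
    · refine (hA i).mem_of_isEmb h.left (hv.comp hv') (hU i) fun z => ?_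
      obtain ⟨x, hx⟩ : _ ∈ Set.range a := (hp z).symm ▸ hp'
      exact ⟨x, (hca _ x hx).trans (hci _), hx⟩
    · refine (hA i).mem_of_isEmb h.right (hv.comp hv') (hW i) fun z => ?_
      obtain ⟨x, hx⟩ := (h.cover _).mpr fun h' => hp' ((hp z) ▸ h')
      exact ⟨x, (hcb _ x hx).trans (hci _), hx⟩

/-! ### Adding a vertex, and strict hypergraphs -/

/-- The members of `G * K₁` arise from `G` by adding a vertex `w`. -/
theorem exists_of_mem_join_K1 {G Y : DCHypergraph C} (hY : Y ∈ join ![G, K1]) :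
    ∃ (g : G.V → Y.V) (w : Y.V), IsEmb G Y g ∧ w ∉ Set.range g ∧
      ∀ y, y ≠ w → y ∈ Set.range g := by
  obtain ⟨f, hf⟩ := hY
  let F : Fin 2 → DCHypergraph C := ![G, K1]
  let o : (F 1).V := ()
  refine ⟨fun v => f (duMk F 0 v), f (duMk F 1 o), ⟨fun x y h => ?_, hf 0⟩, ?_, fun y hy => ?_⟩
  · exact (isEmb_duMk F 0).1 (f.injective h)
  · rintro ⟨x, hx⟩
    have h01 : (0 : Fin 2) = 1 := congrArg (duFst F) (f.injective hx)
    exact absurd h01 (by decide)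
  · obtain ⟨x, rfl⟩ := f.surjective y
    by_cases h : duFst F x = 0
    · obtain ⟨v, hv⟩ := exists_duMk_eq h
      exact ⟨v, congrArg f hv⟩
    · obtain ⟨v, hv⟩ := exists_duMk_eq (G := F) (x := x) (i := 1) (by omega)
      exact absurd (congrArg f hv.symm) hy

theorem disjUnion_mem_join {n : ℕ} (H : Fin n → DCHypergraph C) : disjUnion H ∈ join H :=
  ⟨Equiv.refl _, fun i e => (isEmb_duMk H i).2 e⟩

theorem K1_mem_of_vertex {P : Set (DCHypergraph C)} (hP : IsAdditiveInducedHereditary P)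
    {G : DCHypergraph C} (hG : G ∈ P) (v : G.V) : K1 ∈ P := by
  refine hP.of_emb (f := fun _ => v) ⟨fun x y _ => rfl, fun e => ?_⟩ hG
  refine ⟨fun h => absurd h (Set.notMem_empty e), fun h => ?_⟩
  exact absurd (by simp [mapEdge]) (not_forall_eq_of_mem h v)

/-- Without `K1` the property contains only the null hypergraph, which is then strict with
decomposability number `0`, not `1`. -/
theorem K1_mem_of_isIndecomposable {P : Set (DCHypergraph C)}
    (hP : IsAdditiveInducedHereditary P) (h : IsIndecomposable P) : K1 ∈ P := by
  by_contra hK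
  obtain ⟨G, hG⟩ := hP.isProperty.1
  have hs : G ∈ strict P := by
    refine ⟨hG, fun h' => hK ?_⟩
    have hY := disjUnion_mem_join ![G, K1]
    obtain ⟨-, w, -⟩ := exists_of_mem_join_K1 hY
    exact K1_mem_of_vertex hP (h' hY) w
  have h0 : graphDec P G ≤ 0 := by
    refine sSup_le ?_
    rintro _ ⟨-, n, c, hc, rfl⟩
    rcases n with _ | n
    · simp
    · obtain ⟨v, -⟩ := hc.1 0
      exact absurd (K1_mem_of_vertex hP hG v) hK
  have h1 : dec P ≤ 0 := (iInf₂_le G hs).trans h0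
  rw [h] at h1
  exact absurd h1 (by simp)

/-- Colourings of a strict hypergraph use all colours. -/
theorem surjective_of_mem_strict {n : ℕ} {B : Fin n → Set (DCHypergraph C)}
    (hB : ∀ i, IsAdditiveInducedHereditary (B i)) (hK : ∀ i, K1 ∈ B i) {G : DCHypergraph C}
    (hG : G ∈ strict (product B)) {b : G.V → Fin n} (hb : ∀ i, G.induce (b ⁻¹' {i}) ∈ B i) :
    Function.Surjective b := by
  by_contra hs
  obtain ⟨j, hj⟩ := not_forall.mp hs
  obtain ⟨Y, hY, hYB⟩ := Set.not_subset.mp hG.2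
  obtain ⟨g, w, hg, hw, hgw⟩ := exists_of_mem_join_K1 hY
  -- The added vertex receives the missing colour `j` and is alone in its class, so `Y` would lie in
  -- the product.
  have key : ∀ y, ∃ i, (∀ x, g x = y → b x = i) ∧ (y = w → j = i) := by
    intro y
    by_cases hy : y = w
    · exact ⟨j, fun x hx => absurd ⟨x, hx.trans hy⟩ hw, fun _ => rfl⟩
    · obtain ⟨x, rfl⟩ := hgw y hy
      exact ⟨b x, fun x' hx' => by rw [hg.1 hx'], fun h => absurd h hy⟩
  choose c hc hcw using key
  refine hYB ⟨c, fun i => ?_⟩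
  by_cases hi : i = j
  · subst hi
    have hw' : ∀ y ∈ c ⁻¹' {i}, y = w := by
      intro y hy
      by_contra hyw
      obtain ⟨x, rfl⟩ := hgw y hyw
      exact hj ⟨x, (hc _ x rfl).trans hy⟩
    refine (hB i).induce_mem (hK i) (f := fun _ => (() : Unit))
      (fun x hx y hy _ => (hw' x hx).trans (hw' y hy).symm) (fun e he => ?_)
    refine ⟨fun h => ?_, fun h => absurd h (Set.notMem_empty _)⟩
    exact absurd (fun x hx => hw' x (he x hx)) (not_forall_eq_of_mem h w)
  · refine (hB i).induce_mem_of_isEmb hg (hb i) fun y hy => ?_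
    have hyw : y ≠ w := fun h => hi (hy.symm.trans (hcw y h).symm)
    obtain ⟨x, rfl⟩ := hgw y hyw
    exact ⟨x, (hc _ x rfl).trans hy, rfl⟩

/-- Submultiples are described by maps to the base, so enlarging the base only composes `p` with the
embedding. -/
theorem IsSubMultiple.comp_isEmb {G₀ G : DCHypergraph C} {g : G₀.V → G.V} (hg : IsEmb G₀ G g)
    {m k : ℕ} {c : G.V → Fin m} {Z : DCHypergraph C} {p : Z.V → G₀.V} {l : Z.V → Fin k}
    (hZ : IsSubMultiple (fun x => c (g x)) Z p l) : IsSubMultiple c Z (fun x => g (p x)) l := by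
  refine ⟨fun x y h => hZ.ext x y (hg.1 h), fun i e he => ?_⟩
  rw [hZ.mem_iff i e he, hg.2, mapEdge_mapEdge]
  rfl

/-- Decompositions restrict to strict induced subhypergraphs. -/
theorem IsDecomposition.comp_isEmb {P : Set (DCHypergraph C)} (hP : IsAdditiveInducedHereditary P)
    {G₀ G : DCHypergraph C} (hG₀ : G₀ ∈ strict P) {g : G₀.V → G.V} (hg : IsEmb G₀ G g) {m : ℕ}
    {c : G.V → Fin m} (hc : IsDecomposition P G c) :
    IsDecomposition P G₀ (fun x => c (g x)) := by
  classical
  have hs : Function.Surjective fun x => c (g x) := by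
    -- If `G₀` misses part `j`, pick `v` in that part and send the added vertex of any `Y` in `G₀ *
    -- K₁` to `v`. The edges at the new vertex cross parts and are unconstrained, so `Y` is a
    -- submultiple of `G` with `k = 1` and lies in `P`, against strictness.
    by_contra hs
    obtain ⟨j, hj⟩ := not_forall.mp hs
    obtain ⟨v, hv⟩ := hc.1 j
    obtain ⟨Y, hY, hYP⟩ := Set.not_subset.mp hG₀.2
    obtain ⟨g', w, hg', hw, hgw⟩ := exists_of_mem_join_K1 hY
    have key : ∀ y, ∃ u, (∀ x, g' x = y → g x = u) ∧ (y = w → v = u) := by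
      intro y
      by_cases hy : y = w
      · exact ⟨v, fun x hx => absurd ⟨x, hx.trans hy⟩ hw, fun _ => rfl⟩
      · obtain ⟨x, rfl⟩ := hgw y hy
        exact ⟨g x, fun x' hx' => by rw [hg'.1 hx'], fun h => absurd h hy⟩
    choose p hp hpw using key
    have hw' : ∀ y, c (p y) = j → y = w := by
      intro y hy
      by_contra hyw
      obtain ⟨x, rfl⟩ := hgw y hyw
      exact hj ⟨x, (congrArg c (hp _ x rfl)).trans hy⟩
    have hpj : c (p w) = j := (congrArg c (hpw w rfl).symm).trans hv
    refine hYP (hc.mem_of_isSubMultiple hP le_rfl (p := p) (l := fun _ => (0 : Fin 1))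
      ⟨fun x y h _ => ?_, fun i e he => ?_⟩)
    · by_cases hx : x = w
      · subst hx
        exact (hw' y ((congrArg c h).symm.trans hpj)).symm
      · by_cases hy : y = w
        · subst hy
          exact hw' x ((congrArg c h).trans hpj)
        · obtain ⟨x, rfl⟩ := hgw x hx
          obtain ⟨y, rfl⟩ := hgw y hy
          rw [← hp _ x rfl, ← hp _ y rfl] at h
          rw [hg.1 h]
    · rw [and_iff_right ⟨0, fun _ _ => rfl⟩]
      by_cases hi : i = j
      · subst hi
        refine ⟨fun h => ?_, fun h => ?_⟩
        · exact absurd (fun x hx => hw' x (he x hx)) (not_forall_eq_of_mem h w)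
        · refine absurd (forall_mem_mapEdge.mpr fun x hx => ?_) (not_forall_eq_of_mem h v)
          exact (hpw x (hw' x (he x hx))).symm
      · obtain ⟨e, rfl⟩ := exists_mapEdge (f := g') (e := e) fun x hx =>
          hgw x fun h => hi ((he x hx).symm.trans (h ▸ hpj))
        rw [← hg'.2, hg.2, mapEdge_mapEdge, mapEdge_congr]
        exact fun x _ => hp _ x rfl
  by_contra h
  obtain ⟨k, Z, p, l, hk, hZ, hZP⟩ := exists_isSubMultiple_of_not_isDecomposition hs h
  exact hZP (hc.mem_of_isSubMultiple hP hk (hZ.comp_isEmb hg))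

/-! ### Comparing colourings for two factorisations -/

/-- Two partitions of a set into `n` parts with at most `n` common classes agree up to a
permutation of the parts. Otherwise the common refinement has more than `n` parts. -/
theorem exists_refinement {V : Type} [Finite V] {n : ℕ} {U f : V → Fin n}
    (hU : Function.Surjective U) (hf : Function.Surjective f) :
    ∃ (m : ℕ) (c : V → Fin m), Function.Surjective c ∧
      (∀ x y, c x = c y ↔ U x = U y ∧ f x = f y) ∧
      (m ≤ n → ∃ σ : Equiv.Perm (Fin n), ∀ x, f x = σ (U x)) := by
  classical
  let R := Set.range fun x => (U x, f x)
  have : Fintype R := Fintype.ofFinite R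
  let r : V → R := fun x => ⟨(U x, f x), x, rfl⟩
  have hr : Function.Surjective r := by
    rintro ⟨_, x, rfl⟩
    exact ⟨x, rfl⟩
  refine ⟨Fintype.card R, fun x => Fintype.equivFin R (r x),
    (Fintype.equivFin R).surjective.comp hr, fun x y => ?_, fun hm => ?_⟩
  · rw [(Fintype.equivFin R).injective.eq_iff, Subtype.ext_iff]
    exact Prod.ext_iff
  · have h1 : Function.Surjective fun z : R => z.1.1 := fun i => by
      obtain ⟨x, rfl⟩ := hU i
      exact ⟨r x, rfl⟩
    have h2 : Function.Surjective fun z : R => z.1.2 := fun i => by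
      obtain ⟨x, rfl⟩ := hf i
      exact ⟨r x, rfl⟩
    -- With at most `n` common classes, both surjective projections of `R` to `Fin n` are
    -- bijections, and `σ` is the composite of one inverse with the other.
    have hcard : Fintype.card R = Fintype.card (Fin n) := by
      refine le_antisymm (by simpa using hm) (Fintype.card_le_of_surjective _ h1)
    have b1 := (Fintype.bijective_iff_surjective_and_card _).mpr ⟨h1, hcard⟩
    have b2 := (Fintype.bijective_iff_surjective_and_card _).mpr ⟨h2, hcard⟩
    refine ⟨(Equiv.ofBijective _ b1).symm.trans (Equiv.ofBijective _ b2), fun x => ?_⟩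
    have : (Equiv.ofBijective _ b1).symm (U x) = r x :=
      (Equiv.symm_apply_eq _).mpr rfl
    rw [Equiv.trans_apply, this]
    rfl

/-- If `U` is a colouring of `G` for the factorisation `A`, and `G` has no decomposition with more
than `n` parts, then some permutation of `U` is a colouring of `G` for the factorisation `B`. -/
theorem exists_perm_induce_mem {n : ℕ} {A B : Fin n → Set (DCHypergraph C)}
    (hA : ∀ i, IsAdditiveInducedHereditary (A i)) (hB : ∀ i, IsAdditiveInducedHereditary (B i))
    (hAB : product A ⊆ product B) {G : DCHypergraph C} {U : G.V → Fin n}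
    (hU : Function.Surjective U) (hUA : ∀ i, G.induce (U ⁻¹' {i}) ∈ A i)
    (hdec : ∀ (m : ℕ) (c : G.V → Fin m), IsDecomposition (product B) G c → m ≤ n)
    (hsurj : ∀ f : G.V → Fin n, (∀ i, G.induce (f ⁻¹' {i}) ∈ B i) → Function.Surjective f) :
    ∃ σ : Equiv.Perm (Fin n), ∀ i, G.induce (U ⁻¹' {i}) ∈ B (σ i) := by
  classical
  by_contra hno
  have := G.finite_V
  -- The types of the Ramsey argument: the colourings a copy of `G` can receive if the claim fails.
  let T := {f : G.V → Fin n //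
    Function.Surjective f ∧ ¬ ∃ σ : Equiv.Perm (Fin n), ∀ x, f x = σ (U x)}
  have : Fintype T := Fintype.ofFinite T
  have hF : ∀ f : T, ∃ Q : Pattern C U,
      ¬ ∀ i, (blowUp G Q).induce ((fun x => f.1 (buVal Q x)) ⁻¹' {i}) ∈ B i := by
    rintro ⟨f, hf, hσ⟩
    obtain ⟨m, c, hc, hcU, hm⟩ := exists_refinement hU hf
    obtain ⟨k, Z, p, l, -, hZ, hZB⟩ := exists_isSubMultiple_of_not_isDecomposition
      (P := product B) hc fun h => hσ (hm (hdec m c h))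
    exact exists_pattern_of_isSubMultiple hcU hB hZ hZB
  choose F hF using hF
  obtain ⟨Q, hQ⟩ := Pattern.exists_monochromatic F Finset.univ
  -- Colouring every copy by `U` puts the blow-up in the product of `A`; the inclusion recolours it
  -- for `B`.
  obtain ⟨b, hb⟩ := hAB ⟨_, fun i => blowUp_induce_mem (hA i) Q (hUA i)⟩
  have ht : ∀ j, Function.Surjective (fun v => b (buMk Q j v)) ∧
      ¬ ∃ σ : Equiv.Perm (Fin n), ∀ v, b (buMk Q j v) = σ (U v) := by
    intro j
    have hbj : ∀ i, G.induce ((fun v => b (buMk Q j v)) ⁻¹' {i}) ∈ B i := fun i =>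
      (hB i).induce_mem_induce (hb i) (fun x hx => hx) (isEmb_buMk Q j).1.injOn
        fun e _ => (isEmb_buMk Q j).2 e
    refine ⟨hsurj _ hbj, ?_⟩
    rintro ⟨σ, hσ⟩
    refine hno ⟨σ, fun i => ?_⟩
    have h : (fun v => b (buMk Q j v)) ⁻¹' {σ i} = U ⁻¹' {i} := by
      ext v
      simp [hσ]
    exact h ▸ hbj (σ i)
  obtain ⟨f, -, φ, hφ, hφf⟩ := hQ (fun j => ⟨_, ht j⟩) fun _ => Finset.mem_univ _
  refine hF f fun i => (hB i).induce_mem_induce (hb i) (fun x hx => ?_)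
    hφ.isEmb_blowUp.1.injOn fun e _ => hφ.isEmb_blowUp.2 e
  have h1 := congrFun (congrArg Subtype.val (hφf (buIdx _ x))) (buVal _ x)
  exact h1.trans hx

/-- A tuple of members of the factors of one factorisation is, up to order, a tuple of members of
the factors of the other. -/
theorem exists_perm_forall_mem {n : ℕ} {A B : Fin n → Set (DCHypergraph C)}
    (hA : ∀ i, IsAdditiveInducedHereditary (A i)) (hB : ∀ i, IsAdditiveInducedHereditary (B i))
    (hP : IsAdditiveInducedHereditary (product B)) (hAB : product A = product B)
    (hKA : ∀ i, K1 ∈ A i) (hKB : ∀ i, K1 ∈ B i) {G₀ : DCHypergraph C}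
    (hG₀ : G₀ ∈ strict (product B)) (hdec : graphDec (product B) G₀ ≤ n)
    {H : Fin n → DCHypergraph C} (hH : ∀ i, H i ∈ A i) :
    ∃ σ : Equiv.Perm (Fin n), ∀ i, H i ∈ B (σ i) := by
  obtain ⟨U₀, hU₀⟩ : G₀ ∈ product A := hAB ▸ hG₀.1
  -- The summand `G₀` bounds the decompositions and forces all colours; the other summand carries `H
  -- i` in colour `i`.
  obtain ⟨G, a, b, hG⟩ := exists_isDisjSum G₀ (disjUnion H)
  have hdu : ∀ i, (disjUnion H).induce (duFst H ⁻¹' {i}) ∈ A i := by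
    intro i
    refine (hA i).induce_mem_of_isEmb (isEmb_duMk H i) (W := Set.univ)
      ((hA i).of_emb (isEmb_inVal _ _) (hH i)) ?_
    rintro y rfl
    obtain ⟨v, hv⟩ := exists_duMk_eq (x := y) rfl
    exact ⟨v, Set.mem_univ v, hv⟩
  obtain ⟨U, hU, hUa, hUb⟩ := hG.exists_colouring hA hU₀ hdu
  obtain ⟨σ, hσ⟩ := exists_perm_induce_mem hA hB hAB.le (G := G) (U := U) (fun i => by
      obtain ⟨x, hx⟩ := surjective_of_mem_strict hA hKA (hAB ▸ hG₀) hU₀ i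
      exact ⟨a x, (hUa x).trans hx⟩) hU (fun m c hc => by
      have h1 := hc.comp_isEmb hP hG₀ hG.left
      have h2 : (m : ℕ∞) ≤ graphDec (product B) G₀ := le_sSup ⟨hG₀.1, m, _, h1, rfl⟩
      exact_mod_cast h2.trans hdec) (fun f hf i => by
      obtain ⟨x, hx⟩ := surjective_of_mem_strict hB hKB hG₀ (b := fun x => f (a x)) (fun i =>
        (hB i).induce_mem_induce (hf i) (fun x hx => hx) hG.left.1.injOn
          fun e _ => hG.left.2 e) i
      exact ⟨a x, hx⟩)
  refine ⟨σ, fun i => ?_⟩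
  obtain ⟨t, ht, -⟩ := (hG.right.comp (isEmb_duMk H i)).exists_codRestrict (U := U ⁻¹' {i})
    fun x => hUb _
  exact (hB _).of_emb ht (hσ i)

/-! ### From tuples of members to equality of factors -/

/-- The factors of one factorisation are contained in those of another, up to order. -/
theorem exists_perm_forall_subset {n : ℕ} {A B : Fin n → Set (DCHypergraph C)}
    (hA : ∀ i, IsAdditiveInducedHereditary (A i)) (hB : ∀ i, IsAdditiveInducedHereditary (B i))
    (hKA : ∀ i, K1 ∈ A i)
    (h : ∀ H : Fin n → DCHypergraph C, (∀ i, H i ∈ A i) →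
      ∃ σ : Equiv.Perm (Fin n), ∀ i, H i ∈ B (σ i)) :
    ∃ σ : Equiv.Perm (Fin n), ∀ i, A i ⊆ B (σ i) := by
  classical
  by_contra! hno
  -- Tuples defeating single permutations are merged by disjoint unions in each coordinate; heredity
  -- keeps the earlier witnesses valid.
  have key : ∀ S : Finset (Equiv.Perm (Fin n)), ∃ H : Fin n → DCHypergraph C,
      (∀ i, H i ∈ A i) ∧ ∀ σ ∈ S, ∃ i, H i ∉ B (σ i) := by
    intro S
    induction S using Finset.induction_on with
    | empty => exact ⟨fun _ => K1, hKA, by simp⟩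
    | insert σ S hσ ih =>
      obtain ⟨H, hH, hHS⟩ := ih
      obtain ⟨j, hj⟩ := hno σ
      obtain ⟨Z, hZ, hZB⟩ := Set.not_subset.mp hj
      choose Y a b hY using fun i => exists_isDisjSum (H i) (if i = j then Z else K1)
      refine ⟨Y, fun i => (hY i).mem (hA i) (hH i) ?_, fun τ hτ => ?_⟩
      · split_ifs with hi
        · exact hi ▸ hZ
        · exact hKA i
      · rcases Finset.mem_insert.mp hτ with rfl | hτ
        · refine ⟨j, fun hj' => hZB ?_⟩
          have := (hB _).of_emb (hY j).right hj'
          rwa [if_pos rfl] at this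
        · obtain ⟨i, hi⟩ := hHS τ hτ
          exact ⟨i, fun hi' => hi ((hB _).of_emb (hY i).left hi')⟩
  obtain ⟨H, hH, hHS⟩ := key Finset.univ
  obtain ⟨σ, hσ⟩ := h H hH
  obtain ⟨i, hi⟩ := hHS σ (Finset.mem_univ σ)
  exact hi (hσ i)

/-- Going back and forth permutes the indices by `τ * σ`, which has finite order, so each chain of
inclusions closes into a cycle. -/
theorem exists_perm_eq_of_subset {α : Type*} {n : ℕ} {A B : Fin n → Set α}
    (h1 : ∃ σ : Equiv.Perm (Fin n), ∀ i, A i ⊆ B (σ i))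
    (h2 : ∃ τ : Equiv.Perm (Fin n), ∀ i, B i ⊆ A (τ i)) :
    ∃ σ : Equiv.Perm (Fin n), ∀ i, B i = A (σ i) := by
  obtain ⟨σ, hσ⟩ := h1
  obtain ⟨τ, hτ⟩ := h2
  have hπ : ∀ k i, A i ⊆ A (((τ * σ) ^ k) i) := by
    intro k
    induction k with
    | zero => exact fun i => subset_rfl
    | succ k ih =>
      intro i
      rw [pow_succ']
      exact (ih i).trans ((hσ _).trans (hτ _))
  refine ⟨σ⁻¹, fun i => ?_⟩
  obtain ⟨j, rfl⟩ := σ.surjective i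
  have hj : σ⁻¹ (σ j) = j := σ.symm_apply_apply j
  rw [hj]
  refine Set.Subset.antisymm ?_ (hσ j)
  -- One step `τ * σ` is already spent in passing from `A j` to `B (σ j)` and on; the remaining `N`
  -- steps lead back to `A j`.
  obtain ⟨N, hN⟩ : ∃ N, orderOf (τ * σ) = N + 1 :=
    Nat.exists_eq_succ_of_ne_zero (orderOf_pos _).ne'
  have h3 := hπ N ((τ * σ) j)
  rw [← Equiv.Perm.mul_apply, ← pow_succ, ← hN, pow_orderOf_eq_one] at h3
  exact (hτ _).trans h3

theorem exists_mem_strict_graphDec_le {P : Set (DCHypergraph C)} {n : ℕ} (h : dec P = n) :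
    ∃ G ∈ strict P, graphDec P G ≤ n := by
  by_contra! hno
  have h1 : ((n + 1 : ℕ) : ℕ∞) ≤ dec P := le_iInf₂ fun G hG => by
    have := Order.add_one_le_of_lt (hno G hG)
    exact_mod_cast this
  rw [h] at h1
  have : n + 1 ≤ n := by exact_mod_cast h1
  omega

end DCHypergraph

theorem mainTheorem5 {C : Type*} (P : Set (DCHypergraph C))
    (hP : DCHypergraph.IsAdditiveInducedHereditary P)
    (n : ℕ) (hn : (n : ℕ∞) = DCHypergraph.dec P)
    (A B : Fin n → Set (DCHypergraph C))
    (hA : DCHypergraph.IsIndecomposableFactorisation P A)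
    (hB : DCHypergraph.IsIndecomposableFactorisation P B) :
    ∃ σ : Equiv.Perm (Fin n), ∀ i, B i = A (σ i) := by
  obtain ⟨G, hG, hdec⟩ := DCHypergraph.exists_mem_strict_graphDec_le hn.symm
  have hKA := fun i => DCHypergraph.K1_mem_of_isIndecomposable (hA.factor i) (hA.indecomposable i)
  have hKB := fun i => DCHypergraph.K1_mem_of_isIndecomposable (hB.factor i) (hB.indecomposable i)
  have hPA := hA.eq_product
  have hPB := hB.eq_product
  refine DCHypergraph.exists_perm_eq_of_subset
    (DCHypergraph.exists_perm_forall_subset hA.factor hB.factor hKA fun H hH => ?_)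
    (DCHypergraph.exists_perm_forall_subset hB.factor hA.factor hKB fun H hH => ?_)
  · exact DCHypergraph.exists_perm_forall_mem hA.factor hB.factor (hPB ▸ hP) (hPA.symm.trans hPB)
      hKA hKB (hPB ▸ hG) (hPB ▸ hdec) hH
  · exact DCHypergraph.exists_perm_forall_mem hB.factor hA.factor (hPA ▸ hP) (hPB.symm.trans hPA)
      hKB hKA (hPA ▸ hG) (hPA ▸ hdec) hH
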